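/- Let $\mathcal X$ be a smooth projective geometrically irreducible curve over $\mathbb F_q$ with function field $F$, let $P$ be a rational point of $\mathcal X$ with valuation $\nu_P$, and put $R=\bigcup_{m\ge 0}\mathcal L(mP)$, $\rho=-\nu_P$ (with $\rho(0)=-\infty$), and $\Gamma=\rho(R\setminus\{0\})\cap\mathbb N$ (the Weierstrass semigroup of $P$). Let $\mathbb F_{q^r}$ be a finite extension of $\mathbb F_q$ and let $P_1,\dots,P_h$ ($h\ge 1$) be $\mathbb F_{q^r}$-rational points of $\mathcal X$, of degrees $r_1,\dots,r_h$ over $\mathbb F_q$, with pairwise distinct closed points, all different from $P$. For each $i$ let $\pi_i:\mathbb F_{q^{r_i}}\to\mathbb F_q^{r_i}$ be an $\mathbb F_q$-linear isomorphism (so the inner codes are $C_i=\mathbb F_q^{r_i}$). For each $\gamma\in\Gamma$ choose $f_\gamma\in R$ with $\rho(f_\gamma)=\gamma$ (these elements form a basis of $R$ over $\mathbb F_q$). Let $R'=\mathbb F_{q^r}\otimes_{\mathbb F_q}R$, let $\phi:R'\to\mathbb F_{q^r}^h$ be the $\mathbb F_{q^r}$-linear extension of $f\mapsto (f(P_1),\dots,f(P_h))$,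 and write $\phi=(\phi_1,\dots,\phi_h)$. Let $\Delta=\Delta(R',\rho,\phi)$ be the set of those $\gamma\in\Gamma$ for which $\phi(f_\gamma)$ is not in the $\mathbb F_{q^r}$-span of the $\phi(f_\mu)$, $\mu\in\Gamma$, $\mu<\gamma$. For $\eta\in\Delta$ let $\sigma_\Delta(\eta)=\#\{\xi\in\Delta : \xi-\eta\in\Gamma\}$. For $\lambda\in\mathbb N$ let $$E(\lambda,\mathcal R,\mathcal C)=\mathrm{Span}_{\mathbb F_q}\{(\pi_1(f_\eta(P_1)),\dots,\pi_h(f_\eta(P_h))) : \eta\in\Gamma,\ \eta\le\lambda\}\subseteq\mathbb F_q^{r_1+\cdots+r_h},$$ where $\mathcal R=\{r_1,\dots,r_h\}$ and $\mathcal C=\{C_1,\dots,C_h\}$. Then: (a) $\rho$ is a weight function on the $\mathbb F_q$-algebra $R$ with $\rho(R)=\Gamma\cup\{-\infty\}$ (that is, $(R,\rho,\Gamma)$ is an order domain over $\mathbb F_q$); $\phi$ is surjective; for each $i$, $r_i$ is the least $l\ge 1$ with $\phi_i(R)\subseteq\mathbb F_{q^l}$; and $\#\Delta=h$. (b) The one-point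 generalized algebraic geometric code $C(P_1,\dots,P_h;\lambda P;C_1,\dots,C_h)=\{(\pi_1(f(P_1)),\dots,\pi_h(f(P_h))) : f\in\mathcal L(\lambda P)\}$ equals the extended order domain code $E(\lambda,\mathcal R,\mathcal C)$. (c) The minimum distance of $E(\lambda,\mathcal R,\mathcal C)$ is at least $\min\{\sigma_\Delta(\eta) : \eta\in\Delta,\ \eta\le\lambda\}$, and this minimum is at least $h-\lambda$. -/

import Mathlib

open scoped TensorProduct WithZero

noncomputable section

/-! ### Curves through their function fields -/

/-- `F` is the function field of a smooth projective geometrically irreducible curve over the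
(perfect) field `k`: it is finite over a rational function field `k(x)`, and it stays integral
after extending the scalars to an algebraic closure of `k`. -/
structure IsCurveFunctionField (k F : Type*) [Field k] [Field F] [Algebra k F] : Prop where
  exists_finite : ∃ x : F, Transcendental k x ∧
    FiniteDimensional (IntermediateField.adjoin k {x}) F
  geometricallyIntegral : IsDomain (AlgebraicClosure k ⊗[k] F)

/-- A closed point of the smooth projective curve with function field `F`, given by its local
ring: a discrete valuation ring of `F` that contains the constants. -/
structure Place (k F : Type*) [Field k] [Field F] [Algebra k F] where
  ring : ValuationSubring F
  algebraMap_mem : ∀ c : k, algebraMap k F c ∈ ring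
  dvr : IsDiscreteValuationRing ring

namespace Place

variable {k F : Type*} [Field k] [Field F] [Algebra k F] (Q : Place k F)

instance instIsDVR : IsDiscreteValuationRing Q.ring := Q.dvr

instance instAlgebra : Algebra k Q.ring :=
  ((algebraMap k F).codRestrict Q.ring.toSubring Q.algebraMap_mem).toAlgebra

/-- The residue field of the point. -/
abbrev residueField : Type _ := IsLocalRing.ResidueField Q.ring

/-- The degree of the point over `k`. -/
def degree : ℕ := Module.finrank k Q.residueField

/-- The normalised valuation, written multiplicatively: `Q.val f = exp (-ν_Q f)`. -/
def val : Valuation F ℤᵐ⁰ := (IsDiscreteValuationRing.maximalIdeal Q.ring).valuation F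

/-- `ρ = -ν_Q`, with `ρ 0 = -∞`. -/
def poleOrder (f : F) : WithBot ℤ :=
  open Classical in if f = 0 then ⊥ else ((WithZero.log (Q.val f) : ℤ) : WithBot ℤ)

theorem val_le_one_iff (f : F) : Q.val f ≤ 1 ↔ f ∈ Q.ring := by
  constructor
  · intro hf
    obtain ⟨a, rfl⟩ := IsDiscreteValuationRing.exists_lift_of_le_one (A := Q.ring) (K := F) hf
    exact a.2
  · intro hf
    exact (IsDiscreteValuationRing.maximalIdeal Q.ring).valuation_le_one (K := F) ⟨f, hf⟩

theorem val_algebraMap_le_one (c : k) : Q.val (algebraMap k F c) ≤ 1 :=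
  (Q.val_le_one_iff _).2 (Q.algebraMap_mem c)

end Place

/-- The Riemann–Roch space `L(G) = {f | ν_Q(f) ≥ -G(Q) for all Q}` of a divisor `G`. -/
def riemannRochSpace {k F : Type*} [Field k] [Field F] [Algebra k F] (G : Place k F →₀ ℤ) :
    Submodule k F where
  carrier := {f | ∀ Q : Place k F, Q.val f ≤ WithZero.exp (G Q)}
  zero_mem' := fun Q => by simp
  add_mem' := fun {f g} hf hg Q => (Q.val.map_add f g).trans (max_le (hf Q) (hg Q))
  smul_mem' := fun c f hf Q => by
    rw [Algebra.smul_def, map_mul]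
    exact (mul_le_mul' (Q.val_algebraMap_le_one c) (hf Q)).trans_eq (one_mul _)

/-- The ring `R = ⋃_m L(mP)`. -/
def affineRing {k F : Type*} [Field k] [Field F] [Algebra k F] (P : Place k F) :
    Subalgebra k F where
  carrier := {f | ∃ m : ℕ, f ∈ riemannRochSpace (Finsupp.single P (m : ℤ))}
  mul_mem' := by
    rintro f g ⟨m, hf⟩ ⟨n, hg⟩
    refine ⟨m + n, fun Q => ?_⟩
    rw [map_mul, Nat.cast_add, Finsupp.single_add, Finsupp.add_apply, WithZero.exp_add]
    exact mul_le_mul' (hf Q) (hg Q)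
  add_mem' := by
    rintro f g ⟨m, hf⟩ ⟨n, hg⟩
    have mono : ∀ {a b : ℕ}, a ≤ b → ∀ x ∈ riemannRochSpace (Finsupp.single P (a : ℤ)),
        x ∈ riemannRochSpace (Finsupp.single P (b : ℤ)) := by
      intro a b hab x hx Q
      refine (hx Q).trans (WithZero.exp_le_exp.2 ?_)
      exact Finsupp.single_le_single.2 (Int.ofNat_le.2 hab) Q
    exact ⟨max m n, add_mem (mono (le_max_left m n) f hf) (mono (le_max_right m n) g hg)⟩
  algebraMap_mem' := fun c => ⟨0, fun Q => by simpa using Q.val_algebraMap_le_one c⟩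

/-- The Weierstrass semigroup `Γ` of `P`: the pole orders at `P` of the elements of `R`. -/
def weierstrassSemigroup {k F : Type*} [Field k] [Field F] [Algebra k F] (P : Place k F) :
    Set ℕ :=
  {n | ∃ f ∈ affineRing P, P.poleOrder f = ((n : ℤ) : WithBot ℤ)}

theorem affineRing_mem_ring {k F : Type*} [Field k] [Field F] [Algebra k F] {P Q : Place k F}
    (hQ : Q ≠ P) {f : F} (hf : f ∈ affineRing P) : f ∈ Q.ring := by
  obtain ⟨m, hm⟩ := hf
  rw [← Q.val_le_one_iff]
  simpa [Finsupp.single_eq_of_ne hQ] using hm Q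

/-- A point of the curve with coordinates in the extension `K` of `k`: a closed point together
with an embedding of its residue field into `K`. -/
structure CurvePoint (k F K : Type*) [Field k] [Field F] [Algebra k F] [Field K]
    [Algebra k K] where
  place : Place k F
  emb : place.residueField →ₐ[k] K

namespace CurvePoint

variable {k F K : Type*} [Field k] [Field F] [Algebra k F] [Field K] [Algebra k K]
  (T : CurvePoint k F K)

/-- The degree of the point over `k`. -/
def degree : ℕ := T.place.degree

/-- The field of definition `k(T) ⊆ K` of the point; for `k` with `q` elements it is the subfield
of `K` with `q ^ T.degree` elements. -/
def fieldOfDef : IntermediateField k K := T.emb.fieldRange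

/-- The value `f(T)` of a rational function that is regular at `T`. -/
def evalRegular : T.place.ring →ₐ[k] K :=
  T.emb.comp (IsScalarTower.toAlgHom k T.place.ring T.place.residueField)

/-- The value `f(T)`, as an element of the field of definition (`0` if `f` has a pole at `T`). -/
def value (f : F) : T.fieldOfDef :=
  open Classical in
    if hf : f ∈ T.place.ring then ⟨T.evalRegular ⟨f, hf⟩, ⟨_, rfl⟩⟩ else 0

/-- Evaluation at `T ≠ P` on the ring `R = ⋃_m L(mP)`. -/
def evalAffine {P : Place k F} (hT : T.place ≠ P) : affineRing P →ₐ[k] K :=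
  T.evalRegular.comp
    { toFun := fun f => ⟨f, affineRing_mem_ring hT f.2⟩
      map_one' := rfl
      map_mul' := fun _ _ => rfl
      map_zero' := rfl
      map_add' := fun _ _ => rfl
      commutes' := fun _ => rfl }

theorem evalAffine_mem {P : Place k F} (hT : T.place ≠ P) (f : affineRing P) :
    T.evalAffine hT f ∈ T.fieldOfDef := ⟨_, rfl⟩

end CurvePoint

/-- The concatenated word `(π_1 (v_1), …, π_h (v_h))`. -/
def concatWord {k K : Type*} [Field k] [Field K] [Algebra k K] {h : ℕ}
    {L : Fin h → IntermediateField k K} {n : Fin h → ℕ}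
    (π : ∀ i, L i →ₗ[k] (Fin (n i) → k)) (v : ∀ i, L i) : (Σ i : Fin h, Fin (n i)) → k :=
  fun j => π j.1 (v j.1) j.2

/-- The generalized algebraic geometric code `C(P_1, …, P_h; G; C_1, …, C_h)`: all words
`(π_1 (f(P_1)), …, π_h (f(P_h)))` with `f ∈ L(G)`. The inner code `C_i` is the image of `π i`. -/
def gagCode {k F K : Type*} [Field k] [Field F] [Algebra k F] [Field K] [Algebra k K] {h : ℕ}
    (pt : Fin h → CurvePoint k F K) (G : Place k F →₀ ℤ) {n : Fin h → ℕ}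
    (π : ∀ i, (pt i).fieldOfDef →ₗ[k] (Fin (n i) → k)) :
    Set ((Σ i : Fin h, Fin (n i)) → k) :=
  {c | ∃ f ∈ riemannRochSpace G, c = concatWord π fun i => (pt i).value f}

/-! ### Order domain codes -/

/-- `ρ` is a weight function on the `k`-algebra `A` (with values in `ℤ ∪ {-∞}`). -/
structure IsWeightFunction (k : Type*) {A : Type*} [Field k] [CommRing A] [Algebra k A]
    (ρ : A → WithBot ℤ) : Prop where
  eq_bot_iff : ∀ f, ρ f = ⊥ ↔ f = 0
  smul : ∀ (a : k) (f : A), a ≠ 0 → ρ (a • f) = ρ f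
  add_le : ∀ f g, ρ (f + g) ≤ max (ρ f) (ρ g)
  mul_lt : ∀ f g e, ρ f < ρ g → e ≠ 0 → ρ (f * e) < ρ (g * e)
  exists_sub_lt : ∀ f g, f ≠ 0 → g ≠ 0 → ρ f = ρ g → ∃ a : k, a ≠ 0 ∧ ρ (f - a • g) < ρ g
  mul : ∀ f g, ρ (f * g) = ρ f + ρ g

section OrderDomain

variable {k K A : Type*} [Field k] [Field K] [Algebra k K] [CommRing A] [Algebra k A]
  {Γ : Set ℕ} (b : Γ → A) {h : ℕ}

/-- The set `Δ(R', ρ, φ)` for `R' = K ⊗ A` and a morphism `φ : R' → K^h`: the exponents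
`γ ∈ Γ` such that `φ(b_γ)` does not lie in the `K`-span of the `φ(b_μ)` with `μ < γ`. Listed in
increasing order these are the recursively defined exponents `α(1) < α(2) < …`. -/
def jumpSet (φ : K ⊗[k] A →ₐ[K] (Fin h → K)) : Set ℕ :=
  {γ | ∃ hγ : γ ∈ Γ, φ (1 ⊗ₜ[k] b ⟨γ, hγ⟩) ∉
    Submodule.span K {v | ∃ μ : Γ, (μ : ℕ) < γ ∧ v = φ (1 ⊗ₜ[k] b μ)}}

/-- `σ_Δ(μ)`, the number of `η ∈ Δ` with `η - μ ∈ Γ`. -/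
def sigmaCount (Γ Δ : Set ℕ) (μ : ℕ) : ℕ := {η | η ∈ Δ ∧ ∃ γ ∈ Γ, η = μ + γ}.ncard

/-- `min {σ_Δ(η) | η ∈ Δ, η ≤ lam}`. -/
def orderBound (Γ Δ : Set ℕ) (lam : ℕ) : ℕ :=
  sInf {s | ∃ η ∈ Δ, η ≤ lam ∧ s = sigmaCount Γ Δ η}

/-- The extended order domain code `E(λ, 𝓡, 𝓒)`: the `k`-span of the words
`(π_1 (φ_1 (b_η)), …, π_h (φ_h (b_η)))` with `η ∈ Γ`, `η ≤ lam`, where `φ_i` maps `A` into the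
subfield `L i` of `K` and `π i` maps `L i` onto the `i`-th inner code. -/
def extendedCode (φ : K ⊗[k] A →ₐ[K] (Fin h → K)) (L : Fin h → IntermediateField k K)
    (hφ : ∀ i (a : A), φ (1 ⊗ₜ[k] a) i ∈ L i) {n : Fin h → ℕ}
    (π : ∀ i, L i →ₗ[k] (Fin (n i) → k)) (lam : ℕ) :
    Submodule k ((Σ i : Fin h, Fin (n i)) → k) :=
  Submodule.span k {c | ∃ η : Γ, (η : ℕ) ≤ lam ∧
    c = concatWord π fun i => ⟨φ (1 ⊗ₜ[k] b η) i, hφ i (b η)⟩}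

end OrderDomain

/-- The minimum distance of a linear code. -/
def minDistance {k ι : Type*} [Field k] [Fintype ι] (C : Submodule k (ι → k)) : ℕ :=
  open Classical in sInf {d | ∃ x ∈ C, ∃ y ∈ C, x ≠ y ∧ d = hammingDist x y}

/-! ### The evaluation morphism of a one-point code -/

section OnePoint

variable {k F K : Type*} [Field k] [Field F] [Algebra k F] [Field K] [Algebra k K] {h : ℕ}
  (P : Place k F) (pt : Fin h → CurvePoint k F K) (hpt : ∀ i, (pt i).place ≠ P)

/-- The `K`-algebra morphism `φ : R' = K ⊗ R → K^h`, `φ(f) = (f(P_1), …, f(P_h))`. -/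
def evalMorphism : K ⊗[k] affineRing P →ₐ[K] (Fin h → K) :=
  AlgHom.pi fun i => Algebra.TensorProduct.lift (AlgHom.id K K) ((pt i).evalAffine (hpt i))
    fun _ _ => Commute.all _ _

theorem evalMorphism_tmul (f : affineRing P) (i : Fin h) :
    evalMorphism P pt hpt (1 ⊗ₜ[k] f) i = (pt i).evalAffine (hpt i) f := by
  simp [evalMorphism]

theorem evalMorphism_mem (i : Fin h) (f : affineRing P) :
    evalMorphism P pt hpt (1 ⊗ₜ[k] f) i ∈ (pt i).fieldOfDef := by
  rw [evalMorphism_tmul]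
  exact (pt i).evalAffine_mem (hpt i) f

end OnePoint

end

/-! The code statements follow from two inputs: `R` is rich enough in functions, and pole orders at
`P` behave well under multiplication.

Richness. Elements independent modulo `u` are independent over `k(u)`
(`linearIndependent_adjoin_of_mod`). This shows that suitable valuation rings of `F` are discrete,
that a function without poles is algebraic over `k`, and that a transcendental function has finitely
many zeros. A dimension count, which reduces poles away from `P` one power of `t` at a time
(`Place.finrank_le_regularOn_add`), yields a nonconstant element of `R`. Then the local rings at the
points other than `P` are localizations of `R` (`IsCurveFunctionField.exists_mul_mem_affineRing`),
so `R` separates these points and takes every value in their finite residue fields. Hence `φ` is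
onto and the degrees are as claimed.

Order bound. Since `P` is rational, leading terms at `P` can be cancelled by constants; so the
elements of `R` with pole order at most `n` are spanned by the `b γ` with `γ ≤ n`, and `b μ * b γ`
is a nonzero multiple of `b (μ + γ)` up to lower terms. The images of these spans filter `K^h`, with
jumps exactly at `Δ`, whence `#Δ = h`. If a word `v` enters the filtration at level `η`, the
products `φ(b γ) * v` with `η + γ ∈ Δ` enter at distinct levels, so they are independent; they
vanish where `v` does, so the weight of `v` is at least `σ_Δ(η)` (`sigmaCount_le_hammingNorm`). The
maps `π i` are injective and cannot lower the weight. Finally, the elements of `Δ` outside `η + Γ`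
are distinct modulo `η` when `η > 0`, which gives `σ_Δ(η) ≥ h - η`. -/

noncomputable section

/-! ### Places: constants, residues and weak approximation -/

namespace Place

variable {k F : Type*} [Field k] [Field F] [Algebra k F] (Q : Place k F)

theorem ext_ring {P Q : Place k F} (h : P.ring = Q.ring) : P = Q := by
  cases P; cases Q; cases h; rfl

theorem val_algebraMap {c : k} (hc : c ≠ 0) : Q.val (algebraMap k F c) = 1 := by
  refine le_antisymm (Q.val_algebraMap_le_one c) ?_
  have h := Q.val_algebraMap_le_one c⁻¹
  rw [map_inv₀, map_inv₀] at h
  have hc' : Q.val (algebraMap k F c) ≠ 0 := by simpa using hc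
  exact (inv_le_one₀ (zero_lt_iff.2 hc')).1 h

theorem val_smul {c : k} (hc : c ≠ 0) (f : F) : Q.val (c • f) = Q.val f := by
  rw [Algebra.smul_def, map_mul, Q.val_algebraMap hc, one_mul]

theorem val_smul_le (c : k) (f : F) : Q.val (c • f) ≤ Q.val f := by
  rw [Algebra.smul_def, map_mul]
  exact (mul_le_mul_left (Q.val_algebraMap_le_one c) _).trans_eq (one_mul _)

theorem residue_eq_zero_iff (f : Q.ring) : IsLocalRing.residue Q.ring f = 0 ↔ Q.val f < 1 := by
  rw [IsLocalRing.residue_eq_zero_iff]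
  exact ((IsDiscreteValuationRing.maximalIdeal Q.ring).valuation_lt_one_iff_mem (K := F) f).symm

theorem algebraMap_residueField (c : k) :
    algebraMap k Q.residueField c = IsLocalRing.residue Q.ring (algebraMap k Q.ring c) := rfl

theorem mem_ring_of_isIntegral {f : F} (hf : IsIntegral k f) : f ∈ Q.ring := by
  have : IsScalarTower k Q.ring F := .of_algebraMap_eq fun _ => rfl
  obtain ⟨a, rfl⟩ := IsIntegrallyClosed.isIntegral_iff.1 (hf.tower_top (A := Q.ring))
  exact a.2

theorem val_eq_one_of_isAlgebraic {f : F} (hf : IsAlgebraic k f) (h0 : f ≠ 0) : Q.val f = 1 := by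
  refine le_antisymm ((Q.val_le_one_iff f).2 (Q.mem_ring_of_isIntegral hf.isIntegral)) ?_
  have h := (Q.val_le_one_iff _).2 (Q.mem_ring_of_isIntegral hf.inv.isIntegral)
  rw [map_inv₀] at h
  exact (inv_le_one₀ (zero_lt_iff.2 (by simpa using h0))).1 h

theorem transcendental_of_val_ne_one {f : F} (h0 : f ≠ 0) (h : Q.val f ≠ 1) :
    Transcendental k f := fun hf => h (Q.val_eq_one_of_isAlgebraic hf h0)

theorem exists_one_lt_val : ∃ t : F, 1 < Q.val t := by
  obtain ⟨ϖ, hϖ⟩ := IsDiscreteValuationRing.exists_irreducible Q.ring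
  refine ⟨(ϖ : F)⁻¹, ?_⟩
  have h1 : Q.val (ϖ : F) < 1 := by
    rw [← residue_eq_zero_iff, IsLocalRing.residue_eq_zero_iff]
    exact (IsLocalRing.mem_maximalIdeal _).2 hϖ.not_isUnit
  rw [map_inv₀]
  exact (one_lt_inv₀ (zero_lt_iff.2 (by simpa using hϖ.ne_zero))).2 h1

theorem exists_val_sub_lt_one (hQ : Q.degree = 1) {f : F} (hf : Q.val f ≤ 1) :
    ∃ a : k, Q.val (f - algebraMap k F a) < 1 := by
  have hbij : Function.Bijective (algebraMap k Q.residueField) :=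
    Algebra.finrank_eq_one_iff_bijective_algebraMap.1 hQ
  obtain ⟨a, ha⟩ := hbij.2 (IsLocalRing.residue Q.ring ⟨f, (Q.val_le_one_iff f).1 hf⟩)
  refine ⟨a, ?_⟩
  have := (Q.residue_eq_zero_iff
    (⟨f, (Q.val_le_one_iff f).1 hf⟩ - algebraMap k Q.ring a)).1 (by
      rw [map_sub, ← ha, algebraMap_residueField, sub_self])
  exact this

/-- The difference between `f` and its residue is algebraic of value less than `1`, and a nonzero
algebraic element has value `1`. -/
theorem mem_range_of_isAlgebraic (hQ : Q.degree = 1) {f : F} (hf : IsAlgebraic k f) :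
    ∃ a : k, algebraMap k F a = f := by
  obtain ⟨a, ha⟩ := Q.exists_val_sub_lt_one hQ
    ((Q.val_le_one_iff f).2 (Q.mem_ring_of_isIntegral hf.isIntegral))
  refine ⟨a, ?_⟩
  by_contra hne
  exact ha.ne (Q.val_eq_one_of_isAlgebraic (hf.sub (isAlgebraic_algebraMap a))
    (sub_ne_zero.2 (Ne.symm hne)))

/-- The real-valued absolute value attached to a place. -/
def abv : AbsoluteValue F ℝ :=
  (IsDiscreteValuationRing.maximalIdeal Q.ring).adicAbv (b := 2) (by norm_num)

theorem abv_le_abv_iff (f g : F) : Q.abv f ≤ Q.abv g ↔ Q.val f ≤ Q.val g := by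
  rw [← (WithZeroMulInt.toNNReal_strictMono (e := 2) (by norm_num)).le_iff_le]
  exact NNReal.coe_le_coe

theorem abv_lt_abv_iff (f g : F) : Q.abv f < Q.abv g ↔ Q.val f < Q.val g := by
  simpa only [not_le] using (Q.abv_le_abv_iff g f).not

/-- The approximation theorem, in a weak form. -/
theorem exists_one_lt_val_lt_one (P : Place k F) (S : Finset (Place k F)) (hP : P ∉ S) :
    ∃ y : F, 1 < P.val y ∧ ∀ Q ∈ S, Q.val y < 1 := by
  classical
  -- Distinct places give inequivalent absolute values, because the unit ball recovers the valuation
  -- ring.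
  obtain ⟨y, hy, hy'⟩ := AbsoluteValue.exists_one_lt_lt_one_pi_of_not_isEquiv
    (v := fun Q : (insert P S : Finset (Place k F)) => Q.1.abv) (fun Q => by
      obtain ⟨t, ht⟩ := Q.1.exists_one_lt_val
      rw [← map_one Q.1.val, ← abv_lt_abv_iff, map_one] at ht
      refine ⟨t, ?_, ht.ne'⟩
      rintro rfl
      simp at ht
      exact absurd ht (by norm_num)) (fun Q Q' hne he => hne (Subtype.ext (ext_ring (by
        ext f
        have := he f 1
        rwa [abv_le_abv_iff, abv_le_abv_iff, map_one, map_one, val_le_one_iff,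
          val_le_one_iff] at this)))) ⟨P, Finset.mem_insert_self _ _⟩
  refine ⟨y, ?_, fun Q hQ => ?_⟩
  · rwa [← map_one P.val, ← abv_lt_abv_iff, map_one]
  · have := hy' ⟨Q, Finset.mem_insert_of_mem hQ⟩ (fun h => hP (by cases h; exact hQ))
    rwa [← map_one Q.val, ← abv_lt_abv_iff, map_one]

end Place

/-! ### Independence and finiteness over `k(t)` -/

section FunctionField

variable {k F : Type*} [Field k] [Field F] [Algebra k F]

open Polynomial in
/-- Elements of a `k`-algebra `O ∋ u` that are independent modulo `u O` are independent
over `k(u)`. -/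
theorem linearIndependent_adjoin_of_mod {u : F} (hu : u ≠ 0) (O : Subalgebra k F)
    (huO : u ∈ O) {ι : Type*} [Fintype ι] (v : ι → F) (hv : ∀ i, v i ∈ O)
    (h : ∀ c : ι → k, (∃ z ∈ O, ∑ i, c i • v i = u * z) → c = 0) :
    LinearIndependent (IntermediateField.adjoin k {u}) v := by
  -- After clearing denominators a relation has polynomial coefficients. Their constant terms give a
  -- relation modulo `u O`, so they vanish; dividing the relation by `u` then lowers the degrees.
  have key : ∀ (N : ℕ) (p : ι → k[X]), (∀ i, (p i).natDegree < N) →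
      ∑ i, aeval u (p i) * v i = 0 → p = 0 := by
    intro N
    induction N with
    | zero => intro p hp _; funext i; exact absurd (hp i) (Nat.not_lt_zero _)
    | succ N ih =>
      intro p hp hsum
      have hmem : ∀ q : k[X], aeval u q ∈ O := fun q =>
        Algebra.adjoin_le (Set.singleton_subset_iff.2 huO) (aeval_mem_adjoin_singleton k u)
      have hsplit : ∑ i, (p i).coeff 0 • v i = u * ∑ i, -(aeval u (p i).divX * v i) := by
        rw [Finset.sum_neg_distrib, mul_neg, Finset.mul_sum, eq_neg_iff_add_eq_zero,
          ← Finset.sum_add_distrib, ← hsum]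
        refine Finset.sum_congr rfl fun i _ => ?_
        conv_rhs => rw [← divX_mul_X_add (p i)]
        rw [map_add, map_mul, aeval_X, aeval_C, Algebra.smul_def]
        ring
      have hc : (fun i => (p i).coeff 0) = 0 := h _
        ⟨_, O.sum_mem fun i _ => O.neg_mem (O.mul_mem (hmem _) (hv i)), hsplit⟩
      have hc' : ∀ i, (p i).coeff 0 = 0 := fun i => congrFun hc i
      have hdiv : (fun i => (p i).divX) = 0 := by
        -- For constant coefficients the quotients are `0`, whose `natDegree` is not below `0`, so
        -- the induction hypothesis does not cover this case.
        by_cases hN : N = 0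
        · subst hN
          funext i
          rw [natDegree_eq_zero.1 (Nat.lt_one_iff.1 (hp i)) |>.choose_spec.symm]
          simp
        · refine ih _ (fun i => ?_) ?_
          · rw [natDegree_divX_eq_natDegree_tsub_one]
            have := hp i
            omega
          · simp only [hc', zero_smul, Finset.sum_const_zero, Finset.sum_neg_distrib, mul_neg] at hsplit
            simpa [hu] using hsplit.symm
      funext i
      rw [← divX_mul_X_add (p i), hc' i, congrFun hdiv i]
      simp
  open scoped IntermediateField.algebraAdjoinAdjoin in
  rw [← LinearIndependent.iff_fractionRing (Algebra.adjoin k {u})]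
  rw [Fintype.linearIndependent_iff]
  intro g hg i
  have hex : ∀ i, ∃ p : k[X], aeval u p = (g i : F) := fun i => by
    have : (g i : F) ∈ (aeval (R := k) u).range := by
      rw [← Algebra.adjoin_singleton_eq_range_aeval]
      exact (g i).2
    exact this
  choose p hp using hex
  obtain ⟨N, hN⟩ : ∃ N, ∀ i, (p i).natDegree < N :=
    ⟨∑ i, (p i).natDegree + 1, fun i => Nat.lt_succ_of_le
      (Finset.single_le_sum (f := fun i => (p i).natDegree) (fun _ _ => Nat.zero_le _)
        (Finset.mem_univ i))⟩
  have := key N p hN (by simpa [hp, Algebra.smul_def] using hg)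
  apply Subtype.ext
  rw [← hp, this]
  simp

/-- The transcendence degree is one, so `t` alone is a transcendence basis; `F` is then algebraic
and essentially of finite type over `k(t)`, hence finite. -/
theorem IsCurveFunctionField.finiteDimensional_adjoin (hF : IsCurveFunctionField k F) {t : F}
    (ht : Transcendental k t) : FiniteDimensional (IntermediateField.adjoin k {t}) F := by
  obtain ⟨x, hx, hfin⟩ := hF.exists_finite
  have hess : Algebra.EssFiniteType k F := by
    have : Algebra.EssFiniteType k (IntermediateField.adjoin k {x}) :=
      IntermediateField.essFiniteType_iff.2 ⟨{x}, by simp⟩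
    exact Algebra.EssFiniteType.comp k (IntermediateField.adjoin k {x}) F
  have halg : Algebra.IsAlgebraic (Algebra.adjoin k (Set.range fun _ : Unit => x)) F := by
    rw [Set.range_const]
    open scoped IntermediateField.algebraAdjoinAdjoin in
    exact Algebra.IsAlgebraic.trans _ (IntermediateField.adjoin k {x}) F
  have hxb : IsTranscendenceBasis k (fun _ : Unit => x) :=
    ((algebraicIndependent_singleton_iff ()).2 hx).isTranscendenceBasis_iff_isAlgebraic.2 halg
  have htb : IsTranscendenceBasis k (fun _ : Unit => t) :=
    ((algebraicIndependent_singleton_iff ()).2 ht).isTranscendenceBasis_of_lift_trdeg_le_of_finite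
      hxb.lift_cardinalMk_eq_trdeg.ge
  have : Algebra.IsAlgebraic (IntermediateField.adjoin k {t}) F := by
    have := htb.isAlgebraic_field
    rwa [Set.range_const] at this
  have : Algebra.EssFiniteType (IntermediateField.adjoin k {t}) F :=
    Algebra.EssFiniteType.of_comp k _ F
  exact Algebra.finite_of_essFiniteType_of_isAlgebraic

end FunctionField

/-! ### Valuation rings of a function field -/

section FunctionField

variable {k F : Type*} [Field k] [Field F] [Algebra k F]

/-- A valuation ring of a function field has only finitely many values above a given one. -/
theorem IsCurveFunctionField.finite_values (hF : IsCurveFunctionField k F)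
    (V : ValuationSubring F) (hV : ∀ c : k, algebraMap k F c ∈ V) {x : F} (hx0 : x ≠ 0)
    (hx : V.valuation x < 1) : {γ | V.valuation x < γ ∧ γ ≤ 1}.Finite := by
  have hone : ∀ c : k, c ≠ 0 → V.valuation (algebraMap k F c) = 1 := fun c hc => by
    refine le_antisymm ((V.valuation_le_one_iff _).2 (hV c)) ?_
    have h := (V.valuation_le_one_iff _).2 (hV c⁻¹)
    rw [map_inv₀, map_inv₀] at h
    exact (inv_le_one₀ (zero_lt_iff.2 (by simpa using hc))).1 h
  have hxt : Transcendental k x := by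
    intro hxa
    have hint : IsIntegral k x⁻¹ := hxa.inv.isIntegral
    let i : Algebra k V := ((algebraMap k F).codRestrict V.toSubring hV).toAlgebra
    have : IsScalarTower k V F := .of_algebraMap_eq fun _ => rfl
    obtain ⟨a, ha⟩ := IsIntegrallyClosed.isIntegral_iff.1 (hint.tower_top (A := V))
    have h : V.valuation x⁻¹ ≤ 1 := (V.valuation_le_one_iff _).2 (ha ▸ a.2)
    rw [map_inv₀] at h
    exact hx.not_ge ((inv_le_one₀ (zero_lt_iff.2 (by simpa using hx0))).1 h)
  have := hF.finiteDimensional_adjoin hxt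
  by_contra hinf
  obtain ⟨s, hs, hcard⟩ := Set.Infinite.exists_subset_card_eq hinf
    (Module.finrank (IntermediateField.adjoin k {x}) F + 1)
  choose f hf using fun γ => V.valuation_surjective γ
  let O : Subalgebra k F := { V.toSubring with algebraMap_mem' := hV }
  have hO : ∀ z, z ∈ O ↔ V.valuation z ≤ 1 := fun z => (V.valuation_le_one_iff z).symm
  -- In a combination of elements with distinct values, the largest value that occurs survives. It
  -- exceeds the value of `x`, so the combination is not divisible by `x`.
  have hli := linearIndependent_adjoin_of_mod hx0 O ((hO x).2 hx.le)
    (fun γ : s => f γ) (fun γ => (hO _).2 (by rw [hf]; exact (hs γ.2).2)) (by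
      rintro c ⟨z, hz, hsum⟩
      by_contra hc
      obtain ⟨γ₁, hγ₁⟩ := Function.ne_iff.1 hc
      classical
      obtain ⟨γ₀, hγ₀, hmax⟩ := Finset.exists_max_image (Finset.univ.filter fun γ : s => c γ ≠ 0)
        (fun γ => (γ : V.ValueGroup)) ⟨γ₁, by simpa using hγ₁⟩
      have hγ₀' : c γ₀ ≠ 0 := by simpa using hγ₀
      have hterm : ∀ γ : s, c γ ≠ 0 → V.valuation (c γ • f γ) = γ := fun γ hγ => by
        rw [Algebra.smul_def, map_mul, hone _ hγ, one_mul, hf]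
      have hpos : (0 : V.ValueGroup) < γ₀ := lt_of_le_of_lt zero_le (hs γ₀.2).1
      have hrest : V.valuation (∑ γ ∈ Finset.univ.erase γ₀, c γ • f γ) < γ₀ := by
        refine Valuation.map_sum_lt _ hpos.ne' fun γ hγ => ?_
        by_cases h0 : c γ = 0
        · simpa [h0] using hpos
        · rw [hterm γ h0]
          exact lt_of_le_of_ne (hmax γ (by simpa using h0))
            (fun h => (Finset.mem_erase.1 hγ).1 (Subtype.ext h))
      have hval : V.valuation (∑ γ, c γ • f γ) = γ₀ := by
        rw [← Finset.add_sum_erase _ _ (Finset.mem_univ γ₀),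
          Valuation.map_add_eq_of_lt_left _ (by rwa [hterm _ hγ₀']), hterm _ hγ₀']
      rw [hsum, map_mul] at hval
      have hle : V.valuation x * V.valuation z ≤ V.valuation x :=
        (mul_le_mul_right ((hO z).1 hz) _).trans_eq (mul_one _)
      exact ((hval ▸ hle).trans_lt (hs γ₀.2).1).false)
  have := hli.fintype_card_le_finrank
  rw [Fintype.card_coe] at this
  omega

/-- By finiteness of the values there is a largest one below `1`, and an element attaining it is a
uniformizer. Its powers cannot all stay above the value of a given `y ≠ 0`, as they would be
infinitely many values in a finite set. -/
theorem IsCurveFunctionField.isDiscreteValuationRing (hF : IsCurveFunctionField k F)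
    (V : ValuationSubring F) (hV : ∀ c : k, algebraMap k F c ∈ V) {x : F} (hx0 : x ≠ 0)
    (hx : V.valuation x < 1) : IsDiscreteValuationRing V := by
  have hfin : ∀ y : F, y ≠ 0 → V.valuation y < 1 → {γ | V.valuation y < γ ∧ γ ≤ 1}.Finite :=
    fun y => hF.finite_values V hV
  obtain ⟨γ, ⟨-, hγ1⟩, hγmax⟩ := Set.exists_max_image {γ | V.valuation x ≤ γ ∧ γ < 1} id
    (((hfin x hx0 hx).insert (V.valuation x)).subset fun γ hγ => by
      rcases hγ.1.eq_or_lt with h | h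
      · exact Or.inl h.symm
      · exact Or.inr ⟨h, hγ.2.le⟩) ⟨_, le_rfl, hx⟩
  obtain ⟨ϖ, rfl⟩ := V.valuation_surjective γ
  have hmax : ∀ y, V.valuation y < 1 → V.valuation y ≤ V.valuation ϖ := fun y hy => by
    rcases le_total (V.valuation x) (V.valuation y) with h | h
    · exact hγmax _ ⟨h, hy⟩
    · exact h.trans (hγmax _ ⟨le_rfl, hx⟩)
  have hϖ0 : V.valuation ϖ ≠ 0 := fun h => by
    have := hmax x hx
    rw [h, le_zero_iff] at this
    exact hx0 (by simpa using this)
  have hpos := zero_lt_iff.2 hϖ0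
  refine .ofHasUnitMulPowIrreducibleFactorization
    ⟨⟨ϖ, (V.valuation_le_one_iff _).1 hγ1.le⟩, ?_, ?_⟩
  · refine IsDiscreteValuationRing.irreducible_of_span_eq_maximalIdeal _ (fun h => ?_) ?_
    · exact hϖ0 (by rw [show ϖ = 0 from congrArg Subtype.val h, map_zero])
    · ext a
      rw [V.valuation_lt_one_iff, Ideal.mem_span_singleton]
      constructor
      · intro ha
        obtain ⟨c, hc⟩ := (V.valuation_le_iff _ _).1 (hmax _ ha)
        exact ⟨c, Subtype.ext (by rw [← hc]; exact mul_comm _ _)⟩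
      · rintro ⟨c, rfl⟩
        refine lt_of_le_of_lt ?_ hγ1
        exact (V.valuation_le_iff _ _).2 ⟨c, mul_comm _ _⟩
  · rintro ⟨y, hyV⟩ hy
    have hy0 : y ≠ 0 := fun h => hy (Subtype.ext h)
    have hy1 := (V.valuation_le_one_iff _).2 hyV
    have hex : ∃ m : ℕ, V.valuation ϖ ^ m ≤ V.valuation y := by
      rcases hy1.eq_or_lt with h | h
      · exact ⟨0, by simp [h]⟩
      by_contra! hall
      refine Set.infinite_range_of_injective (f := fun m : ℕ => V.valuation ϖ ^ m)
        (pow_right_strictAnti₀ hpos hγ1).injective ((hfin y hy0 h).subset ?_)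
      rintro _ ⟨m, rfl⟩
      exact ⟨hall m, pow_le_one₀ zero_le hγ1.le⟩
    classical
    obtain ⟨m, hm, hmin⟩ : ∃ m, V.valuation ϖ ^ m ≤ V.valuation y ∧
        ∀ l < m, V.valuation y < V.valuation ϖ ^ l :=
      ⟨Nat.find hex, Nat.find_spec hex, fun l hl => not_le.1 (Nat.find_min hex hl)⟩
    refine ⟨m, ?_⟩
    have heq : V.valuation y = V.valuation (ϖ ^ m) := by
      rw [map_pow]
      refine le_antisymm ?_ hm
      rcases m with _ | m
      · simpa using hy1
      · have h := hmin m (Nat.lt_succ_self m)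
        have h' : V.valuation (y / ϖ ^ m) < 1 := by
          rwa [map_div₀, map_pow, div_lt_one₀ (pow_pos hpos m)]
        have := hmax _ h'
        rwa [map_div₀, map_pow, div_le_iff₀ (pow_pos hpos m), ← pow_succ'] at this
    obtain ⟨a, ha⟩ := (V.valuation_eq_iff _ _).1 heq
    exact ⟨a, Subtype.ext ((mul_comm _ _).trans ha)⟩

/-- A function without poles is constant. -/
theorem IsCurveFunctionField.isAlgebraic_of_forall_mem (hF : IsCurveFunctionField k F) {f : F}
    (hf : ∀ Q : Place k F, f ∈ Q.ring) : IsAlgebraic k f := by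
  by_contra htr
  have hf0 : f ≠ 0 := fun h => htr (h ▸ isAlgebraic_zero)
  let A := Algebra.adjoin k {f⁻¹}
  have hu : f⁻¹ ∈ A := Algebra.self_mem_adjoin_singleton k _
  -- As `f` is transcendental, `f⁻¹` is not a unit of `k[f⁻¹]`; a valuation ring in which `f⁻¹`
  -- stays a nonunit is a place where `f` has a pole.
  obtain ⟨V, hAV, hV⟩ := Ideal.image_subset_nonunits_valuationSubring (A := A.toSubring)
    (Ideal.span {⟨f⁻¹, hu⟩}) (by
      rw [Ne, Ideal.span_singleton_eq_top]
      intro hunit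
      obtain ⟨⟨b, hb⟩, hab⟩ := hunit.exists_right_inv
      have hbf : b = f := by
        have := congrArg Subtype.val hab
        change f⁻¹ * b = 1 at this
        field_simp at this
        exact this
      subst hbf
      have hb' : b ∈ Algebra.adjoin k {b⁻¹} := hb
      rw [Algebra.adjoin_singleton_eq_range_aeval] at hb'
      obtain ⟨p, hp⟩ := hb'
      have hp' : Polynomial.aeval b⁻¹ p = b := hp
      refine (show Transcendental k b⁻¹ from fun h => htr (by simpa using h.inv))
        ⟨p * Polynomial.X - 1, ?_, ?_⟩
      · intro h0
        have := congrArg (Polynomial.eval 0) h0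
        simp at this
      · simp [hp', hf0])
  have hlt : V.valuation f⁻¹ < 1 := by
    have : f⁻¹ ∈ V.nonunits := hV ⟨⟨f⁻¹, hu⟩, Ideal.mem_span_singleton_self _, rfl⟩
    exact this
  have hk : ∀ c : k, algebraMap k F c ∈ V := fun c => hAV (A.algebraMap_mem c)
  have hfV := hf ⟨V, hk, hF.isDiscreteValuationRing V hk (inv_ne_zero hf0) hlt⟩
  have h1 := (V.valuation_le_one_iff f).2 hfV
  rw [map_inv₀] at hlt
  exact hlt.not_ge ((one_le_inv₀ (zero_lt_iff.2 (by simpa using hf0))).2 h1)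

end FunctionField

/-! ### Zeros of a function and dimension counts at finitely many places -/

section FunctionField

variable {k F : Type*} [Field k] [Field F] [Algebra k F]

theorem exists_pow_le_of_lt_one {a b : ℤᵐ⁰} (ha : a < 1) (hb : b ≠ 0) :
    ∃ N : ℕ, ∀ n, N ≤ n → a ^ n ≤ b := by
  obtain ⟨N, hN⟩ := exists_pow_lt₀ ha (Units.mk0 b hb)
  exact ⟨N, fun n hn => (pow_le_pow_of_le_one zero_le ha.le hn).trans hN.le⟩

theorem exists_le_pow_of_one_lt {a : ℤᵐ⁰} (ha : 1 < a) (b : ℤᵐ⁰) :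
    ∃ N : ℕ, ∀ n, N ≤ n → b ≤ a ^ n := by
  rcases eq_or_ne b 0 with rfl | hb
  · exact ⟨0, fun _ _ => zero_le⟩
  obtain ⟨N, hN⟩ := exists_pow_le_of_lt_one (inv_lt_one_of_one_lt₀ ha) (inv_ne_zero hb)
  refine ⟨N, fun n hn => ?_⟩
  have := hN n hn
  rwa [inv_pow, inv_le_inv₀ (pow_pos (zero_lt_one.trans ha) n) (zero_lt_iff.2 hb)] at this

theorem Finset.exists_uniform_nat {α : Type*} (S : Finset α) {p : α → ℕ → Prop}
    (h : ∀ a ∈ S, ∃ N : ℕ, ∀ n, N ≤ n → p a n) : ∃ N : ℕ, ∀ a ∈ S, ∀ n, N ≤ n → p a n := by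
  have : ∀ᶠ n in Filter.atTop, ∀ a ∈ S, p a n :=
    (Filter.eventually_all_finset S).2 fun a ha => Filter.eventually_atTop.2 (h a ha)
  obtain ⟨N, hN⟩ := Filter.eventually_atTop.1 this
  exact ⟨N, fun a ha n hn => hN n hn a ha⟩

namespace Place

/-- A function that is close to `1` at `P` and small at the other places of a finite set. -/
theorem exists_near_one (P : Place k F) (S : Finset (Place k F)) (hP : P ∉ S) {u : F}
    (hu : u ≠ 0) : ∃ w : F, P.val (w - 1) < 1 ∧ ∀ Q ∈ S, Q.val w ≤ Q.val u := by
  obtain ⟨y, hy, hyS⟩ := P.exists_one_lt_val_lt_one S hP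
  obtain ⟨N, hN⟩ := S.exists_uniform_nat (p := fun Q n => Q.val y ^ n ≤ Q.val u)
    fun Q hQ => exists_pow_le_of_lt_one (hyS Q hQ) (by simpa using hu)
  have hPy : 1 < P.val (y ^ (N + 1)) := by
    rw [map_pow]
    exact one_lt_pow₀ hy (Nat.succ_ne_zero N)
  have hPy1 : P.val (1 + y ^ (N + 1)) = P.val (y ^ (N + 1)) :=
    Valuation.map_add_eq_of_lt_right _ (by rwa [map_one])
  have hne : 1 + y ^ (N + 1) ≠ 0 := fun h => by
    rw [h, map_zero] at hPy1
    exact (zero_le.trans_lt hPy).ne hPy1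
  -- High powers make this quotient close to `1` where `y` is large and close to `0` where `y` is
  -- small. The exponent must be positive for the strict inequalities.
  refine ⟨y ^ (N + 1) / (1 + y ^ (N + 1)), ?_, fun Q hQ => ?_⟩
  · rw [show y ^ (N + 1) / (1 + y ^ (N + 1)) - 1 = -(1 + y ^ (N + 1))⁻¹ by field_simp; ring,
      Valuation.map_neg, map_inv₀, hPy1]
    exact inv_lt_one_of_one_lt₀ hPy
  · have h1 : Q.val (1 + y ^ (N + 1)) = 1 := by
      rw [Valuation.map_add_eq_of_lt_left, map_one]
      rw [map_one, map_pow]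
      exact pow_lt_one₀ zero_le (hyS Q hQ) (Nat.succ_ne_zero N)
    rw [map_div₀, h1, div_one, map_pow]
    exact hN Q hQ _ (Nat.le_succ N)

/-- The functions that are regular at all places of `S`. -/
def regularOn (S : Set (Place k F)) : Subalgebra k F where
  carrier := {f | ∀ Q ∈ S, Q.val f ≤ 1}
  mul_mem' := fun {f g} hf hg Q hQ => by
    rw [map_mul]
    exact mul_le_one' (hf Q hQ) (hg Q hQ)
  add_mem' := fun {f g} hf hg Q hQ => (Q.val.map_add f g).trans (max_le (hf Q hQ) (hg Q hQ))
  algebraMap_mem' := fun c Q _ => Q.val_algebraMap_le_one c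

theorem mem_regularOn {S : Set (Place k F)} {f : F} :
    f ∈ regularOn S ↔ ∀ Q ∈ S, Q.val f ≤ 1 := Iff.rfl

/-- The functions whose values on `S` are bounded by those of `g`. -/
def boundedOn (S : Set (Place k F)) (g : F) : Submodule k F where
  carrier := {f | ∀ Q ∈ S, Q.val f ≤ Q.val g}
  zero_mem' := fun Q _ => by simp
  add_mem' := fun {f g} hf hg Q hQ => (Q.val.map_add f g).trans (max_le (hf Q hQ) (hg Q hQ))
  smul_mem' := fun c f hf Q hQ => (Q.val_smul_le c f).trans (hf Q hQ)

/-- For finitely many zeros of `u`, functions that are close to `1` at one zero and divisible by `u`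
at the others are independent modulo `u`, so there are at most `[F : k(u)]` zeros. -/
theorem finite_setOf_val_lt_one (hF : IsCurveFunctionField k F) {u : F} (hu : Transcendental k u) :
    {Q : Place k F | Q.val u < 1}.Finite := by
  have hu0 : u ≠ 0 := fun h => hu (h ▸ isAlgebraic_zero)
  have := hF.finiteDimensional_adjoin hu
  by_contra hinf
  obtain ⟨S, hS, hcard⟩ := Set.Infinite.exists_subset_card_eq hinf
    (Module.finrank (IntermediateField.adjoin k {u}) F + 1)
  classical
  choose w hw1 hwS using fun Q : Place k F =>
    Q.exists_near_one (S.erase Q) (Finset.notMem_erase Q S) hu0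
  have hw1' : ∀ Q : Place k F, Q.val (w Q) = 1 := fun Q => by
    rw [← sub_add_cancel (w Q) 1, Valuation.map_add_eq_of_lt_right, map_one]
    rw [map_one]
    exact hw1 Q
  have hli := linearIndependent_adjoin_of_mod hu0 (regularOn (S : Set (Place k F)))
    (fun Q hQ => (hS hQ).le) (fun Q : S => w Q) (fun (Q : S) Q' hQ' => by
      by_cases h : Q' = Q
      · rw [h, hw1']
      · exact (hwS Q Q' (Finset.mem_erase.2 ⟨h, hQ'⟩)).trans (hS hQ').le) (by
      rintro c ⟨z, hz, hsum⟩
      funext Q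
      by_contra hc
      have hlt : Q.1.val (∑ Q' ∈ Finset.univ.erase Q, c Q' • w Q') < 1 := by
        refine Valuation.map_sum_lt _ one_ne_zero fun Q' hQ' => ?_
        refine (Q.1.val_smul_le _ _).trans_lt ((hwS _ _ ?_).trans_lt (hS Q.2))
        exact Finset.mem_erase.2 ⟨fun h => (Finset.mem_erase.1 hQ').1 (Subtype.ext h.symm), Q.2⟩
      have hval : Q.1.val (∑ Q', c Q' • w Q') = 1 := by
        rw [← Finset.add_sum_erase _ _ (Finset.mem_univ Q), Valuation.map_add_eq_of_lt_left]
        · rw [val_smul _ hc, hw1']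
        · rwa [val_smul _ hc, hw1']
      rw [hsum, map_mul] at hval
      exact (mul_lt_one_of_lt_of_le (hS Q.2) (hz Q.1 Q.2)).ne hval)
  have := hli.fintype_card_le_finrank
  rw [Fintype.card_coe] at this
  omega

/-- A consequence of the fundamental inequality: a space of functions regular on `S` and
independent modulo `u` has dimension less than `[F : k(u)]`, if `u` has a zero outside `S`. -/
theorem finrank_lt_of_mod {u : F} (hu : u ≠ 0)
    [FiniteDimensional (IntermediateField.adjoin k {u}) F] (P : Place k F)
    (hPu : P.val u < 1) (S : Finset (Place k F)) (hPS : P ∉ S) (hS : ∀ Q ∈ S, Q.val u < 1)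
    (W : Submodule k F) [FiniteDimensional k W]
    (hW : W ≤ Subalgebra.toSubmodule (regularOn (S : Set (Place k F))))
    (hmod : ∀ f ∈ W, f ∈ boundedOn (S : Set (Place k F)) u → f = 0) :
    Module.finrank k W < Module.finrank (IntermediateField.adjoin k {u}) F := by
  classical
  obtain ⟨w, hw1, hwS⟩ := P.exists_near_one S hPS hu
  let z := Module.finBasis k W
  -- The function `1 - w` vanishes at `P`, so a high power of it removes the poles of the basis
  -- there. On `S` it is `1` modulo `u`, so the basis does not change modulo `u`.
  obtain ⟨M, hM⟩ := Finset.univ.exists_uniform_nat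
    (p := fun i n => P.val (1 - w) ^ n * P.val (z i : F) ≤ 1) fun i _ => by
      by_cases hzi : (z i : F) = 0
      · exact ⟨0, fun _ _ => by simp [hzi]⟩
      · have h0 : P.val (z i : F) ≠ 0 := by simpa using hzi
        obtain ⟨N, hN⟩ := exists_pow_le_of_lt_one (a := P.val (1 - w))
          (by rwa [Valuation.map_sub_swap]) (inv_ne_zero h0)
        exact ⟨N, fun n hn => (le_inv_mul_iff₀' (zero_lt_iff.2 h0)).1 (by simpa using hN n hn)⟩
  have hwO : w ∈ regularOn (S : Set (Place k F)) := fun Q hQ => (hwS Q hQ).trans (hS Q hQ).le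
  have hx : 1 - w ∈ regularOn (S : Set (Place k F)) := Subalgebra.sub_mem _ (one_mem _) hwO
  have hdiff : ∀ i, (1 - w) ^ M * (z i : F) - z i ∈ boundedOn (S : Set (Place k F)) u := by
    intro i Q hQ
    rw [show (1 - w) ^ M * (z i : F) - z i = w * (-(∑ j ∈ Finset.range M, (1 - w) ^ j) * z i) by
      rw [← sub_one_mul, ← geom_sum_mul]; ring, map_mul]
    refine (mul_le_mul' (hwS Q hQ) ?_).trans_eq (mul_one _)
    exact (mul_mem (neg_mem (sum_mem fun j _ => pow_mem hx j)) (hW (z i).2) :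
      _ ∈ regularOn (S : Set (Place k F))) Q hQ
  have hPw : P.val w = 1 := by
    rw [← sub_add_cancel w 1, Valuation.map_add_eq_of_lt_right, map_one]
    rwa [map_one]
  -- The extra element `w`, which is a unit at `P` and divisible by `u` on `S`, makes the inequality
  -- strict.
  have hli := linearIndependent_adjoin_of_mod hu
    (regularOn ((insert P S : Finset (Place k F)) : Set (Place k F)))
    (fun Q hQ => by
      rcases Finset.mem_insert.1 (Finset.mem_coe.1 hQ) with rfl | h
      · exact hPu.le
      · exact (hS Q h).le)
    (fun o : Option (Fin (Module.finrank k W)) => o.elim w fun i => (1 - w) ^ M * (z i : F))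
    (fun o Q hQ => by
      rcases Finset.mem_insert.1 (Finset.mem_coe.1 hQ) with rfl | h
      · rcases o with _ | i
        · exact hPw.le
        · simpa using hM i (Finset.mem_univ i) M le_rfl
      · rcases o with _ | i
        · exact hwO Q h
        · exact (mul_mem (pow_mem hx M) (hW (z i).2) : _ ∈ regularOn (S : Set (Place k F))) Q h) (by
      rintro c ⟨y, hy, hsum⟩
      rw [Fintype.sum_option] at hsum
      simp only [Option.elim] at hsum
      have hz : ∑ i, c (some i) • (z i : F) = 0 := by
        refine hmod _ (W.sum_mem fun i _ => W.smul_mem _ (z i).2) ?_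
        rw [show ∑ i, c (some i) • (z i : F) = u * y - c none • w -
            ∑ i, c (some i) • ((1 - w) ^ M * (z i : F) - z i) by
          rw [← hsum]; simp only [smul_sub, Finset.sum_sub_distrib]; ring]
        refine sub_mem (sub_mem (fun Q hQ => ?_) (Submodule.smul_mem _ _ hwS))
          (sum_mem fun i _ => Submodule.smul_mem _ _ (hdiff i))
        rw [map_mul]
        exact (mul_le_mul' le_rfl (hy Q (Finset.mem_insert_of_mem hQ))).trans_eq (mul_one _)
      have hc : ∀ i, c (some i) = 0 := by
        refine Fintype.linearIndependent_iff.1 z.linearIndependent _ (Subtype.ext ?_)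
        simpa using hz
      funext o
      rcases o with _ | i
      · by_contra h0
        simp only [hc, zero_smul, Finset.sum_const_zero, add_zero] at hsum
        have := congrArg P.val hsum
        rw [val_smul _ h0, hPw, map_mul] at this
        exact (mul_lt_one_of_lt_of_le hPu (hy P (Finset.mem_insert_self _ _))).ne this.symm
      · exact hc i)
  have := hli.fintype_card_le_finrank
  rw [Fintype.card_option, Fintype.card_fin] at this
  omega

/-- Lowering the pole bound from `t ^ (M + 1)` to `t ^ M` costs at most `[F : k(t⁻¹)] - 1`
dimensions: a complement of the smaller space, divided by `t ^ (M + 1)`, is regular on `S` and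
independent modulo `t⁻¹`. The `- 1` comes from the pole `P` of `t` outside `S`. -/
theorem finrank_le_regularOn_add {t : F} (hPt : Transcendental k t) (P : Place k F)
    [FiniteDimensional (IntermediateField.adjoin k {t⁻¹}) F]
    (hP : 1 < P.val t) (S : Finset (Place k F)) (hPS : P ∉ S) (hS : ∀ Q ∈ S, 1 < Q.val t)
    (M : ℕ) (V : Submodule k F) [FiniteDimensional k V]
    (hV : V ≤ boundedOn (S : Set (Place k F)) (t ^ M)) :
    Module.finrank k V ≤
      Module.finrank k (V ⊓ Subalgebra.toSubmodule (regularOn (S : Set (Place k F))) :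
        Submodule k F) +
      M * (Module.finrank (IntermediateField.adjoin k {t⁻¹}) F - 1) := by
  have ht0 : t ≠ 0 := fun h => hPt (h ▸ isAlgebraic_zero)
  induction M generalizing V with
  | zero =>
    rw [inf_eq_left.2 fun f hf Q hQ => by simpa using hV hf Q hQ]
    omega
  | succ M ih =>
    let V' : Submodule k F := V ⊓ boundedOn (S : Set (Place k F)) (t ^ M)
    have hV' := ih V' inf_le_right
    have hle : Module.finrank k (V' ⊓ Subalgebra.toSubmodule (regularOn (S : Set (Place k F))) :
        Submodule k F) ≤ Module.finrank k (V ⊓ Subalgebra.toSubmodule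
        (regularOn (S : Set (Place k F))) : Submodule k F) :=
      Submodule.finrank_mono (inf_le_inf_right _ inf_le_left)
    obtain ⟨C, hC⟩ := Submodule.exists_isCompl (V'.comap V.subtype)
    let μ : F →ₗ[k] F := LinearMap.mulLeft k (t⁻¹ ^ (M + 1))
    have hμ : Function.Injective μ := mul_right_injective₀ (pow_ne_zero _ (inv_ne_zero ht0))
    have hdim : Module.finrank k V = Module.finrank k V' + Module.finrank k C := by
      rw [← Submodule.finrank_add_eq_of_isCompl hC]
      congr 1
      exact (Submodule.comapSubtypeEquivOfLe inf_le_left).finrank_eq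
    have hCdim : Module.finrank k ((C.map V.subtype).map μ) = Module.finrank k C := by
      rw [← (Submodule.equivMapOfInjective μ hμ _).finrank_eq,
        ← (Submodule.equivMapOfInjective _ V.injective_subtype C).finrank_eq]
    have hCt : ∀ f ∈ C.map V.subtype, f ∈ V ∧ (f ∈ V' → f = 0) := by
      rintro _ ⟨f, hf, rfl⟩
      refine ⟨f.2, fun h => ?_⟩
      have : f = 0 := by simpa using hC.disjoint.le_bot ⟨h, hf⟩
      simp [this]
    have hval : ∀ Q ∈ S, 0 < Q.val t := fun Q hQ => zero_lt_one.trans (hS Q hQ)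
    have := finrank_lt_of_mod (inv_ne_zero ht0) P
      (by rw [map_inv₀]; exact inv_lt_one_of_one_lt₀ hP) S hPS
      (fun Q hQ => by rw [map_inv₀]; exact inv_lt_one_of_one_lt₀ (hS Q hQ))
      ((C.map V.subtype).map μ) (by
        rintro _ ⟨f, hf, rfl⟩ Q hQ
        have h := hV (hCt f hf).1 Q hQ
        rw [map_pow] at h
        change Q.val (t⁻¹ ^ (M + 1) * f) ≤ 1
        rw [map_mul, map_pow, map_inv₀, inv_pow]
        exact (inv_mul_le_one₀ (pow_pos (hval Q hQ) _)).2 h) (by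
        rintro _ ⟨f, hf, rfl⟩ h
        suffices f = 0 by rw [this, map_zero]
        refine (hCt f hf).2 ⟨(hCt f hf).1, fun Q hQ => ?_⟩
        have h := h Q hQ
        change Q.val (t⁻¹ ^ (M + 1) * f) ≤ _ at h
        rw [map_mul, map_pow, map_inv₀, inv_pow, inv_mul_le_iff₀ (pow_pos (hval Q hQ) _), pow_succ,
          mul_inv_cancel_right₀ (hval Q hQ).ne'] at h
        rwa [map_pow])
    rw [hCdim] at this
    rw [hdim, Nat.succ_mul]
    omega

end Place

end FunctionField

/-! ### A nonconstant function with its only pole at `P` -/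

section FunctionField

variable {k F : Type*} [Field k] [Field F] [Algebra k F]

theorem mem_riemannRochSpace_single {P : Place k F} {m : ℤ} {f : F} :
    f ∈ riemannRochSpace (Finsupp.single P m) ↔
      P.val f ≤ WithZero.exp m ∧ ∀ Q : Place k F, Q ≠ P → f ∈ Q.ring := by
  constructor
  · intro h
    refine ⟨by simpa using h P, fun Q hQ => ?_⟩
    rw [← Q.val_le_one_iff]
    simpa [Finsupp.single_eq_of_ne hQ] using h Q
  · rintro ⟨hP, h⟩ Q
    by_cases hQ : Q = P
    · subst hQ; simpa using hP
    · simpa [Finsupp.single_eq_of_ne hQ] using (Q.val_le_one_iff f).2 (h Q hQ)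

theorem mem_affineRing_iff {P : Place k F} {f : F} :
    f ∈ affineRing P ↔ ∀ Q : Place k F, Q ≠ P → f ∈ Q.ring := by
  refine ⟨fun hf Q hQ => affineRing_mem_ring hQ hf, fun h => ?_⟩
  refine ⟨(WithZero.log (P.val f)).toNat, mem_riemannRochSpace_single.2 ⟨?_, h⟩⟩
  exact WithZero.le_exp_of_log_le (Int.self_le_toNat _)

theorem linearIndependent_pow_of_transcendental {t : F} (ht : Transcendental k t) :
    LinearIndependent k fun i : ℕ => t ^ i := by
  have := (Polynomial.basisMonomials k).linearIndependent.map'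
    (Polynomial.aeval (R := k) t).toLinearMap
    (LinearMap.ker_eq_bot.2 (transcendental_iff_injective.1 ht))
  rwa [show ⇑(Polynomial.aeval (R := k) t).toLinearMap ∘ ⇑(Polynomial.basisMonomials k) =
    fun i : ℕ => t ^ i by funext i; simp] at this

theorem IntermediateField.adjoin_singleton_inv (t : F) :
    IntermediateField.adjoin k {t⁻¹} = IntermediateField.adjoin k {t} := by
  refine le_antisymm ?_ ?_
  · exact IntermediateField.adjoin_simple_le_iff.2
      (inv_mem (IntermediateField.mem_adjoin_simple_self k t))
  · refine IntermediateField.adjoin_simple_le_iff.2 ?_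
    simpa using inv_mem (IntermediateField.mem_adjoin_simple_self k t⁻¹)

theorem linearIndependent_pow_mul {t : F} (ht : Transcendental k t) {ι : Type*} {y : ι → F}
    (hy : LinearIndependent (IntermediateField.adjoin k {t}) y) (m : ℕ) :
    LinearIndependent k fun p : Fin m × ι => t ^ (p.1 : ℕ) * y p.2 := by
  have hpow : LinearIndependent k
      (fun i : Fin m => (IntermediateField.AdjoinSimple.gen k t) ^ (i : ℕ)) := by
    refine LinearIndependent.of_comp (IntermediateField.val _).toLinearMap ?_
    exact (linearIndependent_pow_of_transcendental ht).comp _ Fin.val_injective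
  exact linearIndependent_smul hpow hy

/-- A function field has a basis over `k(t)` whose elements are regular outside the poles
of `t`. -/
theorem IsCurveFunctionField.exists_regular_basis (hF : IsCurveFunctionField k F) {t : F}
    (ht : Transcendental k t) :
    ∃ (s : Finset F) (y : Module.Basis s (IntermediateField.adjoin k {t}) F),
      ∀ (j : s) (Q : Place k F), Q.val t ≤ 1 → Q.val (y j) ≤ 1 := by
  classical
  have hfin := hF.finiteDimensional_adjoin ht
  open scoped IntermediateField.algebraAdjoinAdjoin in
  obtain ⟨s, y, hy⟩ := FiniteDimensional.exists_is_basis_integral (Algebra.adjoin k {t})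
    (IntermediateField.adjoin k {t}) F
  refine ⟨s, y, fun j Q hQ => ?_⟩
  have hle : ∀ a ∈ Algebra.adjoin k {t}, a ∈ Q.ring := by
    intro a ha
    have h : Algebra.adjoin k {t} ≤ Place.regularOn {Q} :=
      Algebra.adjoin_le (by simpa [Place.mem_regularOn] using hQ)
    exact (Q.val_le_one_iff a).1 (h ha Q rfl)
  have hint : IsIntegral Q.ring (y j) := by
    obtain ⟨p, hp, hp0⟩ := hy j
    let φ : Algebra.adjoin k {t} →+* Q.ring :=
      (algebraMap (Algebra.adjoin k {t}) F).codRestrict Q.ring.toSubring fun a => hle a a.2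
    refine ⟨p.map φ, hp.map φ, ?_⟩
    rw [Polynomial.eval₂_map]
    exact hp0
  obtain ⟨a, ha⟩ := IsIntegrallyClosed.isIntegral_iff.1 hint
  rw [Q.val_le_one_iff, ← ha]
  exact a.2

/-- There is a nonconstant function whose only pole is `P`. -/
theorem IsCurveFunctionField.exists_transcendental_mem_affineRing
    (hF : IsCurveFunctionField k F) {P : Place k F} (hP : P.degree = 1) :
    ∃ x ∈ affineRing P, Transcendental k x := by
  classical
  obtain ⟨t, hPt⟩ := P.exists_one_lt_val
  have ht0 : t ≠ 0 := by
    rintro rfl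
    simp at hPt
  have htr : Transcendental k t := P.transcendental_of_val_ne_one ht0 hPt.ne'
  have htr' : Transcendental k t⁻¹ := fun h => htr (by simpa using h.inv)
  have hfin := hF.finiteDimensional_adjoin htr
  have hfin' := hF.finiteDimensional_adjoin htr'
  have hn : Module.finrank (IntermediateField.adjoin k {t⁻¹}) F =
      Module.finrank (IntermediateField.adjoin k {t}) F := by
    rw [IntermediateField.adjoin_singleton_inv]
  obtain ⟨s, y, hyreg⟩ := hF.exists_regular_basis htr
  have hSfin : {Q : Place k F | 1 < Q.val t ∧ Q ≠ P}.Finite :=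
    (Place.finite_setOf_val_lt_one hF htr').subset fun Q hQ => by
      change Q.val t⁻¹ < 1
      rw [map_inv₀]
      exact inv_lt_one_of_one_lt₀ hQ.1
  let S := hSfin.toFinset
  have hS : ∀ Q, Q ∈ S ↔ 1 < Q.val t ∧ Q ≠ P := fun Q => hSfin.mem_toFinset
  obtain ⟨C, hC⟩ := S.exists_uniform_nat (p := fun Q n => ∀ j, Q.val (y j) ≤ Q.val t ^ n)
    fun Q hQ => by
      obtain ⟨N, hN⟩ := Finset.univ.exists_uniform_nat
        (p := fun j n => Q.val (y j) ≤ Q.val t ^ n)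
        fun j _ => exists_le_pow_of_one_lt ((hS Q).1 hQ).1 _
      exact ⟨N, fun n hn j => hN j (Finset.mem_univ j) n hn⟩
  set n := Module.finrank (IntermediateField.adjoin k {t}) F with hndef
  -- The space `V` has dimension `(m + 1) * n`, and regularity on `S` costs at most `(m + C) * (n -
  -- 1)`. With this `m` at least `n + C + 1 ≥ 2` dimensions remain, more than the constants fill.
  let m := n * C + 1
  let T : Fin (m + 1) × s → F := fun p => t ^ (p.1 : ℕ) * y p.2
  have hT : LinearIndependent k T := linearIndependent_pow_mul htr y.linearIndependent (m + 1)
  let V := Submodule.span k (Set.range T)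
  have : FiniteDimensional k V := FiniteDimensional.span_of_finite k (Set.finite_range T)
  have hVdim : Module.finrank k V = (m + 1) * n := by
    rw [finrank_span_eq_card hT, Fintype.card_prod, Fintype.card_fin, hndef,
      Module.finrank_eq_card_basis y]
  have hTval : ∀ p (Q : Place k F), Q.val (T p) = Q.val t ^ (p.1 : ℕ) * Q.val (y p.2) := fun p Q =>
    (Q.val.map_mul _ _).trans (by rw [map_pow])
  have hVle : V ≤ Place.boundedOn (S : Set (Place k F)) (t ^ (m + C)) := by
    refine Submodule.span_le.2 ?_
    rintro _ ⟨p, rfl⟩ Q hQ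
    rw [hTval, map_pow, pow_add]
    exact mul_le_mul' (pow_le_pow_right₀ ((hS Q).1 hQ).1.le (Nat.lt_succ_iff.1 p.1.2))
      (hC Q hQ C le_rfl p.2)
  have hVreg : ∀ f ∈ V, ∀ Q : Place k F, Q.val t ≤ 1 → Q.val f ≤ 1 := by
    intro f hf Q hQ
    have : V ≤ Subalgebra.toSubmodule (Place.regularOn {Q}) := by
      refine Submodule.span_le.2 ?_
      rintro _ ⟨p, rfl⟩ Q' rfl
      rw [hTval]
      exact mul_le_one' (pow_le_one₀ zero_le hQ) (hyreg _ _ hQ)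
    exact this hf Q rfl
  have hineq := Place.finrank_le_regularOn_add htr P hPt S (fun h => ((hS P).1 h).2 rfl)
    (fun Q hQ => ((hS Q).1 hQ).1) (m + C) V hVle
  have hnpos : 0 < n := Module.finrank_pos
  have htwo : 2 ≤ Module.finrank k (V ⊓ Subalgebra.toSubmodule
      (Place.regularOn (S : Set (Place k F))) : Submodule k F) := by
    rw [hVdim, hn] at hineq
    obtain ⟨n', hn'⟩ : ∃ n', n = n' + 1 := ⟨n - 1, by omega⟩
    rw [hn', Nat.add_sub_cancel] at hineq
    have hm : m = (n' + 1) * C + 1 := by rw [← hn']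
    rw [hm] at hineq
    nlinarith
  by_contra! hno
  have hle : V ⊓ Subalgebra.toSubmodule (Place.regularOn (S : Set (Place k F))) ≤
      Submodule.span k {(1 : F)} := by
    rintro f ⟨hfV, hfS⟩
    have hfR : f ∈ affineRing P := mem_affineRing_iff.2 fun Q hQ => by
      rw [← Q.val_le_one_iff]
      rcases le_or_gt (Q.val t) 1 with h | h
      · exact hVreg f hfV Q h
      · exact hfS Q ((hS Q).2 ⟨h, hQ⟩)
    obtain ⟨a, rfl⟩ := P.mem_range_of_isAlgebraic hP (not_not.1 (hno f hfR))
    exact Submodule.mem_span_singleton.2 ⟨a, by rw [Algebra.smul_def, mul_one]⟩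
  have h1 := Submodule.finrank_mono hle
  have h2 := finrank_span_singleton (K := k) (one_ne_zero (α := F))
  omega

end FunctionField

/-! ### The ring `R` at the points other than `P` -/

section FunctionField

variable {k F : Type*} [Field k] [Field F] [Algebra k F]

open Polynomial in
/-- Every element of `F` is a root of a primitive polynomial over `k[x]`. -/
theorem IsCurveFunctionField.exists_isPrimitive (hF : IsCurveFunctionField k F) {x : F}
    (hx : Transcendental k x) (z : F) :
    ∃ p : k[X][X], p.IsPrimitive ∧ p.eval₂ (aeval x).toRingHom z = 0 := by
  have hfin := hF.finiteDimensional_adjoin hx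
  open scoped IntermediateField.algebraAdjoinAdjoin in
  have halg : Algebra.IsAlgebraic (Algebra.adjoin k {x}) F :=
    Algebra.IsAlgebraic.trans _ (IntermediateField.adjoin k {x}) F
  obtain ⟨p, hp, hpz⟩ := halg.isAlgebraic z
  let θ : k[X] →+* Algebra.adjoin k {x} :=
    (aeval (R := k) (⟨x, Algebra.self_mem_adjoin_singleton k x⟩ : Algebra.adjoin k {x})).toRingHom
  have hθ : ∀ q, (θ q : F) = aeval x q := fun q =>
    (aeval_algHom_apply (Algebra.adjoin k {x}).val _ q).symm
  have hsurj : Function.Surjective θ := fun a => by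
    have : (a : F) ∈ (aeval (R := k) x).range := by
      rw [← Algebra.adjoin_singleton_eq_range_aeval]
      exact a.2
    obtain ⟨q, hq⟩ := this
    exact ⟨q, Subtype.ext ((hθ q).trans hq)⟩
  obtain ⟨p', rfl⟩ := map_surjective θ hsurj p
  have hp'0 : p' ≠ 0 := fun h => hp (by rw [h, Polynomial.map_zero])
  have hp'z : p'.eval₂ (aeval x).toRingHom z = 0 := by
    rw [aeval_def, eval₂_map] at hpz
    rw [← hpz]
    congr 1
    ext q
    · simp [hθ]
    · simp [hθ]
  let : NormalizedGCDMonoid k[X] := Classical.choice inferInstance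
  refine ⟨p'.primPart, p'.isPrimitive_primPart, ?_⟩
  rw [p'.eq_C_content_mul_primPart, eval₂_mul, eval₂_C, mul_eq_zero] at hp'z
  refine hp'z.resolve_left fun h => ?_
  have := (transcendental_iff_injective.1 hx) (h.trans (map_zero (aeval (R := k) x)).symm)
  exact hp'0 (content_eq_zero_iff.1 this)

open Polynomial in
/-- The local rings of the points other than `P` are localizations of `R`. -/
theorem IsCurveFunctionField.exists_mul_mem_affineRing (hF : IsCurveFunctionField k F)
    {P Q : Place k F} (hP : P.degree = 1) (hQ : Q ≠ P) {z : F} (hz : Q.val z ≤ 1) :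
    ∃ s ∈ affineRing P, Q.val s = 1 ∧ s * z ∈ affineRing P := by
  obtain ⟨x, hxR, hx⟩ := hF.exists_transcendental_mem_affineRing hP
  obtain ⟨p, hp, hpz⟩ := hF.exists_isPrimitive hx z
  let a : ℕ → F := fun l => aeval x (p.coeff l)
  have haR : ∀ l, a l ∈ affineRing P := fun l =>
    Algebra.adjoin_le (Set.singleton_subset_iff.2 hxR) (aeval_mem_adjoin_singleton k x)
  have haval : ∀ l (Q' : Place k F), Q' ≠ P → Q'.val (a l) ≤ 1 := fun l Q' hQ' =>
    (Q'.val_le_one_iff _).2 (mem_affineRing_iff.1 (haR l) Q' hQ')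
  have hsum : ∑ l ∈ Finset.range (p.natDegree + 1), a l * z ^ l = 0 := by
    rw [← hpz, eval₂_eq_sum_range]
    rfl
  -- Otherwise all coefficients lie in the ideal of polynomials in `x` that vanish at `Q`. Its
  -- generator divides the primitive polynomial `p`, hence is a unit, although `1` does not vanish
  -- at `Q`.
  have hex : ∃ l, l ∈ Finset.range (p.natDegree + 1) ∧ Q.val (a l) = 1 := by
    by_contra! hno
    have hlt : ∀ l, Q.val (a l) < 1 := fun l => by
      by_cases hl : l < p.natDegree + 1
      · exact lt_of_le_of_ne (haval l Q hQ) (hno l (Finset.mem_range.2 hl))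
      · simp [a, coeff_eq_zero_of_natDegree_lt (by omega : p.natDegree < l)]
    have hxQ : ∀ q : k[X], Q.val (aeval x q) ≤ 1 := fun q =>
      (Q.val_le_one_iff _).2 (mem_affineRing_iff.1 (Algebra.adjoin_le
        (Set.singleton_subset_iff.2 hxR) (aeval_mem_adjoin_singleton k x)) Q hQ)
    let I : Ideal k[X] :=
      { carrier := {q | Q.val (aeval x q) < 1}
        zero_mem' := by simp
        add_mem' := fun {q r} hq hr => by
          simp only [Set.mem_ofPred_eq, map_add]
          exact (Q.val.map_add _ _).trans_lt (max_lt hq hr)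
        smul_mem' := fun c q hq => by
          simp only [Set.mem_ofPred_eq, smul_eq_mul, map_mul]
          exact (mul_comm _ _).trans_lt (mul_lt_one_of_lt_of_le hq (hxQ c)) }
    obtain ⟨π, hπ⟩ := (IsPrincipalIdealRing.principal I).principal
    have hdvd : C π ∣ p := C_dvd_iff_dvd_coeff π p |>.2 fun l => by
      have hl : p.coeff l ∈ I := hlt l
      rw [hπ] at hl
      exact Ideal.mem_span_singleton.1 hl
    have hone : (1 : k[X]) ∈ I := by
      rw [hπ]
      exact Ideal.mem_span_singleton.2 (hp π hdvd).dvd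
    have : Q.val (aeval x (1 : k[X])) < 1 := hone
    simp at this
  obtain ⟨d, ⟨hd, hd1⟩, hmax⟩ : ∃ d, (d ∈ Finset.range (p.natDegree + 1) ∧ Q.val (a d) = 1) ∧
      ∀ l ∈ Finset.range (p.natDegree + 1), d < l → Q.val (a l) < 1 := by
    classical
    obtain ⟨l, hl, hl1⟩ := hex
    obtain ⟨d, hd, hmax⟩ := Finset.exists_max_image
      ((Finset.range (p.natDegree + 1)).filter fun l => Q.val (a l) = 1) id
      ⟨l, Finset.mem_filter.2 ⟨hl, hl1⟩⟩
    refine ⟨d, Finset.mem_filter.1 hd, fun l hl hdl => lt_of_le_of_ne (haval l Q hQ) fun h => ?_⟩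
    exact hdl.not_ge (hmax l (Finset.mem_filter.2 ⟨hl, h⟩))
  obtain ⟨m, hm⟩ : ∃ m, p.natDegree + 1 = d + (m + 1) :=
    ⟨p.natDegree - d, by have := Finset.mem_range.1 hd; omega⟩
  -- This is the part of the relation from degree `d` on, divided by `z ^ d`. Modulo the maximal
  -- ideal at `Q` only the unit `a d` remains. Where `z` has a pole, the lower part of the relation
  -- shows that `s * z` is still regular.
  let s : F := ∑ j ∈ Finset.range (m + 1), a (d + j) * z ^ j
  have hs : s * z ^ d = -∑ l ∈ Finset.range d, a l * z ^ l := by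
    rw [hm, Finset.sum_range_add] at hsum
    rw [eq_neg_iff_add_eq_zero, ← hsum, add_comm, Finset.sum_mul]
    congr 1
    exact Finset.sum_congr rfl fun j _ => by ring
  have hreg : ∀ Q' : Place k F, Q' ≠ P → Q'.val z ≤ 1 → Q'.val s ≤ 1 := fun Q' hQ' hz' =>
    Valuation.map_sum_le _ fun j _ => by
      rw [map_mul, map_pow]
      exact mul_le_one' (haval _ Q' hQ') (pow_le_one₀ zero_le hz')
  have hpole : ∀ Q' : Place k F, Q' ≠ P → 1 < Q'.val z → Q'.val s * Q'.val z ≤ 1 := by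
    intro Q' hQ' hz'
    have hz0 : 0 < Q'.val z := zero_lt_one.trans hz'
    rcases d with _ | d
    · have : s = 0 := by simpa using hs
      simp [this]
    have h := congrArg Q'.val hs
    rw [map_mul, map_pow, Valuation.map_neg] at h
    have hle : Q'.val (∑ l ∈ Finset.range (d + 1), a l * z ^ l) ≤ Q'.val z ^ d :=
      Valuation.map_sum_le _ fun l hl => by
        rw [map_mul, map_pow]
        exact (mul_le_mul' (haval _ Q' hQ') (pow_le_pow_right₀ hz'.le
          (Nat.lt_succ_iff.1 (Finset.mem_range.1 hl)))).trans_eq (one_mul _)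
    rw [← h, pow_succ', ← mul_assoc] at hle
    exact (mul_le_iff_le_one_left (pow_pos hz0 d)).1 hle
  refine ⟨s, mem_affineRing_iff.2 fun Q' hQ' => ?_, ?_, mem_affineRing_iff.2 fun Q' hQ' => ?_⟩
  · rw [← Q'.val_le_one_iff]
    rcases le_or_gt (Q'.val z) 1 with h | h
    · exact hreg Q' hQ' h
    · exact (le_mul_of_one_le_right zero_le h.le).trans (hpole Q' hQ' h)
  · have hlt : Q.val (∑ j ∈ Finset.range m, a (d + (j + 1)) * z ^ (j + 1)) < 1 :=
      Valuation.map_sum_lt _ one_ne_zero fun j hj => by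
        rw [map_mul, map_pow]
        refine mul_lt_one_of_lt_of_le (hmax _ ?_ (by omega)) (pow_le_one₀ zero_le hz)
        have := Finset.mem_range.1 hj
        exact Finset.mem_range.2 (by omega)
    have hs0 : s = (∑ j ∈ Finset.range m, a (d + (j + 1)) * z ^ (j + 1)) + a d := by
      simp only [s]
      rw [Finset.sum_range_succ']
      simp
    rw [hs0, Valuation.map_add_eq_of_lt_right _ (by rwa [hd1]), hd1]
  · rw [← Q'.val_le_one_iff, map_mul]
    rcases le_or_gt (Q'.val z) 1 with h | h
    · exact mul_le_one' (hreg Q' hQ' h) h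
    · exact hpole Q' hQ' h

/-- `R` maps onto the (finite) residue fields of the points other than `P`. -/
theorem IsCurveFunctionField.exists_mem_affineRing_val_sub_lt (hF : IsCurveFunctionField k F)
    {P Q : Place k F} (hP : P.degree = 1) (hQ : Q ≠ P) [Finite Q.residueField] {z : F}
    (hz : Q.val z ≤ 1) : ∃ f ∈ affineRing P, Q.val (f - z) < 1 := by
  obtain ⟨s, hs, hs1, hsz⟩ := hF.exists_mul_mem_affineRing hP hQ hz
  have := Fintype.ofFinite Q.residueField
  obtain ⟨N, hN⟩ : ∃ N, Fintype.card Q.residueField - 1 = N + 1 :=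
    ⟨_, (Nat.succ_pred_eq_of_pos (Nat.sub_pos_of_lt Fintype.one_lt_card)).symm⟩
  -- The order of the multiplicative group of the residue field is `N + 1`, so the factor `s ^ (N +
  -- 1)`, which clears the poles of `z`, is `1` at `Q`.
  refine ⟨s ^ N * (s * z), mul_mem (pow_mem hs N) hsz, ?_⟩
  let s' : Q.ring := ⟨s, (Q.val_le_one_iff s).1 hs1.le⟩
  have hs0 : IsLocalRing.residue Q.ring s' ≠ 0 := fun h =>
    ((Q.residue_eq_zero_iff s').1 h).ne hs1
  have h1 : IsLocalRing.residue Q.ring (s' ^ (N + 1) - 1) = 0 := by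
    rw [map_sub, map_pow, map_one, ← hN, FiniteField.pow_card_sub_one_eq_one _ hs0, sub_self]
  have h2 : Q.val (s ^ (N + 1) - 1) < 1 := (Q.residue_eq_zero_iff _).1 h1
  rw [show s ^ N * (s * z) - z = (s ^ (N + 1) - 1) * z by ring, map_mul]
  exact mul_lt_one_of_lt_of_le h2 hz

/-- Approximation separates the two places by some function of `F`; a denominator that is a unit at
`Q'` moves it into `R`, and its regularity at `Q` preserves the zero there. -/
theorem IsCurveFunctionField.exists_mem_affineRing_separating (hF : IsCurveFunctionField k F)
    {P Q Q' : Place k F} (hP : P.degree = 1) (hQ : Q ≠ P) (hQ' : Q' ≠ P) (hne : Q ≠ Q') :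
    ∃ g ∈ affineRing P, Q.val g < 1 ∧ Q'.val g = 1 := by
  obtain ⟨t, ht⟩ := Q.exists_one_lt_val
  have ht0 : t⁻¹ ≠ 0 := inv_ne_zero fun h => by simp [h] at ht
  obtain ⟨w, hw1, hwQ⟩ := Q'.exists_near_one {Q} (by simpa using hne.symm) ht0
  have hwQ' : Q.val w < 1 := (hwQ Q (Finset.mem_singleton_self Q)).trans_lt (by
    rw [map_inv₀]; exact inv_lt_one_of_one_lt₀ ht)
  have hw : Q'.val w = 1 := by
    rw [← sub_add_cancel w 1, Valuation.map_add_eq_of_lt_right, map_one]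
    rwa [map_one]
  obtain ⟨s, hs, hs1, hsw⟩ := hF.exists_mul_mem_affineRing hP hQ' hw.le
  refine ⟨s * w, hsw, ?_, by rw [map_mul, hs1, hw, one_mul]⟩
  rw [map_mul]
  exact (mul_comm _ _).trans_lt (mul_lt_one_of_lt_of_le hwQ'
    ((Q.val_le_one_iff s).2 (mem_affineRing_iff.1 hs Q hQ)))

end FunctionField

/-! ### Pole orders and leading terms at `P` -/

namespace Place

variable {k F : Type*} [Field k] [Field F] [Algebra k F] (P : Place k F)

theorem poleOrder_zero : P.poleOrder 0 = ⊥ := if_pos rfl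

theorem poleOrder_of_ne_zero {f : F} (hf : f ≠ 0) :
    P.poleOrder f = ((WithZero.log (P.val f) : ℤ) : WithBot ℤ) := if_neg hf

theorem poleOrder_eq_bot_iff {f : F} : P.poleOrder f = ⊥ ↔ f = 0 := by
  refine ⟨fun h => ?_, fun h => h ▸ P.poleOrder_zero⟩
  by_contra hf
  rw [P.poleOrder_of_ne_zero hf] at h
  exact WithBot.coe_ne_bot h

theorem poleOrder_le_iff {f g : F} : P.poleOrder f ≤ P.poleOrder g ↔ P.val f ≤ P.val g := by
  by_cases hf : f = 0
  · simp [hf, poleOrder_zero]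
  by_cases hg : g = 0
  · rw [hg, poleOrder_zero, le_bot_iff, poleOrder_eq_bot_iff, map_zero, le_zero_iff, map_eq_zero]
  rw [P.poleOrder_of_ne_zero hf, P.poleOrder_of_ne_zero hg, WithBot.coe_le_coe,
    WithZero.log_le_log (by simpa using hf) (by simpa using hg)]

theorem poleOrder_lt_iff {f g : F} : P.poleOrder f < P.poleOrder g ↔ P.val f < P.val g := by
  simpa only [not_le] using (P.poleOrder_le_iff (f := g) (g := f)).not

theorem poleOrder_eq_coe_iff {f : F} {n : ℤ} :
    P.poleOrder f = (n : WithBot ℤ) ↔ P.val f = WithZero.exp n := by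
  by_cases hf : f = 0
  · simp [hf, poleOrder_zero, WithZero.exp_ne_zero.symm]
  · rw [P.poleOrder_of_ne_zero hf, WithBot.coe_inj]
    constructor
    · rintro rfl
      exact (WithZero.exp_log (by simpa using hf)).symm
    · intro h
      rw [h, WithZero.log_exp]

theorem poleOrder_mul (f g : F) : P.poleOrder (f * g) = P.poleOrder f + P.poleOrder g := by
  by_cases hf : f = 0
  · simp [hf, poleOrder_zero]
  by_cases hg : g = 0
  · simp [hg, poleOrder_zero]
  rw [P.poleOrder_of_ne_zero hf, P.poleOrder_of_ne_zero hg,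
    P.poleOrder_of_ne_zero (mul_ne_zero hf hg), map_mul,
    WithZero.log_mul (by simpa using hf) (by simpa using hg), WithBot.coe_add]

variable {P} in
theorem ne_zero_of_val_eq_exp {f : F} {n : ℤ} (h : P.val f = WithZero.exp n) : f ≠ 0 := by
  rintro rfl
  exact WithZero.exp_ne_zero (h.symm.trans (map_zero _))

/-- The residue of `f / g` is a constant because `P` is rational. -/
theorem exists_val_sub_smul_lt (hP : P.degree = 1) {f g : F} (hg : g ≠ 0)
    (h : P.val f = P.val g) : ∃ a : k, a ≠ 0 ∧ P.val (f - a • g) < P.val g := by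
  have hg' : P.val g ≠ 0 := by simpa using hg
  have hfg : P.val (f / g) = 1 := by rw [map_div₀, h, div_self hg']
  obtain ⟨a, ha⟩ := P.exists_val_sub_lt_one hP hfg.le
  refine ⟨a, ?_, ?_⟩
  · rintro rfl
    rw [map_zero, sub_zero] at ha
    exact ha.ne hfg
  · rw [show f - a • g = (f / g - algebraMap k F a) * g by
      rw [Algebra.smul_def, sub_mul, div_mul_cancel₀ _ hg], map_mul]
    exact mul_lt_of_lt_one_left (zero_lt_iff.2 hg') ha

end Place

/-! ### The weight function and the basis indexed by `Γ` -/

section AffineRing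

variable {k F : Type*} [Field k] [Field F] [Algebra k F] {P : Place k F}

/-- Such an `f` has no poles at all, so it is algebraic; if nonzero, it would have value `1` at `P`.
-/
theorem eq_zero_of_mem_affineRing_of_val_lt_one (hF : IsCurveFunctionField k F) {f : F}
    (hf : f ∈ affineRing P) (h : P.val f < 1) : f = 0 := by
  by_contra h0
  refine h.ne (P.val_eq_one_of_isAlgebraic (hF.isAlgebraic_of_forall_mem fun Q => ?_) h0)
  by_cases hQ : Q = P
  · rw [hQ, ← P.val_le_one_iff]
    exact h.le
  · exact mem_affineRing_iff.1 hf Q hQ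

theorem isWeightFunction_poleOrder (hP : P.degree = 1) :
    IsWeightFunction k (fun f : affineRing P => P.poleOrder (f : F)) where
  eq_bot_iff f := by rw [P.poleOrder_eq_bot_iff, ZeroMemClass.coe_eq_zero]
  smul a f ha := by
    have h : P.val ((a • f : affineRing P) : F) = P.val (f : F) := P.val_smul ha _
    exact le_antisymm (P.poleOrder_le_iff.2 h.le) (P.poleOrder_le_iff.2 h.ge)
  add_le f g := by
    rcases le_total (P.val (f : F)) (P.val (g : F)) with h | h
    · refine le_max_of_le_right (P.poleOrder_le_iff.2 ?_)
      exact (P.val.map_add _ _).trans (max_le h le_rfl)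
    · refine le_max_of_le_left (P.poleOrder_le_iff.2 ?_)
      exact (P.val.map_add _ _).trans (max_le le_rfl h)
  mul_lt f g e h he := by
    have he' : 0 < P.val (e : F) := zero_lt_iff.2 (by simpa using he)
    rw [P.poleOrder_lt_iff] at h ⊢
    simpa only [MulMemClass.coe_mul, map_mul] using mul_lt_mul_of_pos_right h he'
  exists_sub_lt f g _ hg h := by
    have hval : P.val (f : F) = P.val (g : F) :=
      le_antisymm (P.poleOrder_le_iff.1 h.le) (P.poleOrder_le_iff.1 h.ge)
    obtain ⟨a, ha, hlt⟩ := P.exists_val_sub_smul_lt hP (by simpa using hg) hval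
    exact ⟨a, ha, P.poleOrder_lt_iff.2 hlt⟩
  mul f g := P.poleOrder_mul _ _

theorem mem_weierstrassSemigroup_iff {n : ℕ} :
    n ∈ weierstrassSemigroup P ↔ ∃ f ∈ affineRing P, P.val f = WithZero.exp (n : ℤ) := by
  simp only [weierstrassSemigroup, Set.mem_ofPred_eq, Place.poleOrder_eq_coe_iff]

theorem exists_val_eq_exp (hF : IsCurveFunctionField k F) {f : F} (hf : f ∈ affineRing P)
    (h0 : f ≠ 0) : ∃ n ∈ weierstrassSemigroup P, P.val f = WithZero.exp (n : ℤ) := by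
  have h1 : 1 ≤ P.val f := not_lt.1 fun h => h0 (eq_zero_of_mem_affineRing_of_val_lt_one hF hf h)
  have hval : P.val f ≠ 0 := by simpa using h0
  obtain ⟨n, hn⟩ := Int.eq_ofNat_of_zero_le (a := WithZero.log (P.val f)) (by
    rwa [← WithZero.log_one, WithZero.log_le_log one_ne_zero hval])
  have h : P.val f = WithZero.exp (n : ℤ) := by rw [← hn, WithZero.exp_log hval]
  exact ⟨n, mem_weierstrassSemigroup_iff.2 ⟨f, hf, h⟩, h⟩

theorem range_poleOrder (hF : IsCurveFunctionField k F) :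
    Set.range (fun f : affineRing P => P.poleOrder (f : F)) =
      insert ⊥ ((fun n : ℕ => ((n : ℤ) : WithBot ℤ)) '' weierstrassSemigroup P) := by
  ext x
  constructor
  · rintro ⟨f, rfl⟩
    by_cases hf : (f : F) = 0
    · exact Or.inl (P.poleOrder_eq_bot_iff.2 hf)
    · obtain ⟨n, hn, hval⟩ := exists_val_eq_exp hF f.2 hf
      exact Or.inr ⟨n, hn, (P.poleOrder_eq_coe_iff.2 hval).symm⟩
  · rintro (rfl | ⟨n, ⟨f, hf, hfn⟩, rfl⟩)
    · exact ⟨0, P.poleOrder_zero⟩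
    · exact ⟨⟨f, hf⟩, hfn⟩

theorem zero_mem_weierstrassSemigroup : 0 ∈ weierstrassSemigroup P :=
  mem_weierstrassSemigroup_iff.2 ⟨1, one_mem _, by simp⟩

theorem add_mem_weierstrassSemigroup {m n : ℕ} (hm : m ∈ weierstrassSemigroup P)
    (hn : n ∈ weierstrassSemigroup P) : m + n ∈ weierstrassSemigroup P := by
  obtain ⟨f, hf, hfm⟩ := mem_weierstrassSemigroup_iff.1 hm
  obtain ⟨g, hg, hgn⟩ := mem_weierstrassSemigroup_iff.1 hn
  refine mem_weierstrassSemigroup_iff.2 ⟨f * g, mul_mem hf hg, ?_⟩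
  rw [map_mul, hfm, hgn, Nat.cast_add, WithZero.exp_add]

variable {b : weierstrassSemigroup P → affineRing P}

/-- Induction on the pole order: a multiple of the basis element of the same order cancels the
leading term. At `n = 0` the function vanishes at `P` and is therefore `0`. -/
theorem mem_span_of_val_lt (hF : IsCurveFunctionField k F) (hP : P.degree = 1)
    (hb : ∀ γ, P.val (b γ : F) = WithZero.exp ((γ : ℕ) : ℤ)) (n : ℕ) (f : affineRing P)
    (hf : P.val (f : F) < WithZero.exp (n : ℤ)) :
    f ∈ Submodule.span k (b '' {ν | (ν : ℕ) < n}) := by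
  induction n generalizing f with
  | zero =>
    have : f = 0 := Subtype.ext
      (eq_zero_of_mem_affineRing_of_val_lt_one hF f.2 (by simpa using hf))
    rw [this]
    exact zero_mem _
  | succ n ih =>
    have hmono : Submodule.span k (b '' {ν | (ν : ℕ) < n}) ≤
        Submodule.span k (b '' {ν | (ν : ℕ) < n + 1}) :=
      Submodule.span_mono (Set.image_mono fun ν (hν : (ν : ℕ) < n) => hν.trans (Nat.lt_succ_self n))
    by_cases h0 : (f : F) = 0
    · rw [show f = 0 from Subtype.ext h0]
      exact zero_mem _
    obtain ⟨m, hm, hval⟩ := exists_val_eq_exp hF f.2 h0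
    rw [hval, WithZero.exp_lt_exp, Nat.cast_lt, Nat.lt_succ_iff] at hf
    rcases hf.eq_or_lt with rfl | hlt
    · obtain ⟨a, -, ha⟩ := P.exists_val_sub_smul_lt hP (f := f) (g := b ⟨m, hm⟩)
        (Place.ne_zero_of_val_eq_exp (hb _)) (by rw [hval, hb])
      rw [hb] at ha
      rw [← sub_add_cancel f (a • b ⟨m, hm⟩)]
      refine add_mem (hmono (ih _ ha)) (Submodule.smul_mem _ _ (Submodule.subset_span ?_))
      exact ⟨⟨m, hm⟩, Nat.lt_succ_self m, rfl⟩
    · exact hmono (ih f (by rwa [hval, WithZero.exp_lt_exp, Nat.cast_lt]))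

/-- This is the only multiplicative property of the basis that the order bound uses. -/
theorem mul_sub_smul_mem_span (hF : IsCurveFunctionField k F) (hP : P.degree = 1)
    (hb : ∀ γ, P.val (b γ : F) = WithZero.exp ((γ : ℕ) : ℤ)) (μ γ : weierstrassSemigroup P) :
    ∃ a : k, a ≠ 0 ∧ b μ * b γ - a • b ⟨μ + γ, add_mem_weierstrassSemigroup μ.2 γ.2⟩ ∈
      Submodule.span k (b '' {ν | (ν : ℕ) < μ + γ}) := by
  obtain ⟨a, ha0, ha⟩ := P.exists_val_sub_smul_lt hP (f := (b μ * b γ : affineRing P))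
    (g := b ⟨μ + γ, add_mem_weierstrassSemigroup μ.2 γ.2⟩)
    (Place.ne_zero_of_val_eq_exp (hb _)) (by
      rw [MulMemClass.coe_mul, map_mul, hb, hb, hb, Nat.cast_add, WithZero.exp_add])
  rw [hb] at ha
  exact ⟨a, ha0, mem_span_of_val_lt hF hP hb _ _ ha⟩

end AffineRing

/-! ### The order bound -/

section OrderBound

variable {k K A : Type*} [Field k] [Field K] [Algebra k K] [CommRing A] [Algebra k A]
  {Γ : Set ℕ} (b : Γ → A) {h : ℕ} (φ : K ⊗[k] A →ₐ[K] (Fin h → K))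

/-- The span of the images of the basis elements of exponent less than `n`. -/
def evalFiltration (n : ℕ) : Submodule K (Fin h → K) :=
  Submodule.span K {v | ∃ μ : Γ, (μ : ℕ) < n ∧ v = φ (1 ⊗ₜ[k] b μ)}

variable {b φ}

theorem mem_jumpSet_iff {γ : ℕ} : γ ∈ jumpSet b φ ↔
    ∃ hγ : γ ∈ Γ, φ (1 ⊗ₜ[k] b ⟨γ, hγ⟩) ∉ evalFiltration b φ γ := Iff.rfl

theorem evalFiltration_mono : Monotone (evalFiltration b φ) := fun _ _ hmn =>
  Submodule.span_mono fun _ ⟨μ, hμ, hv⟩ => ⟨μ, hμ.trans_le hmn, hv⟩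

theorem evalFiltration_zero : evalFiltration b φ 0 = ⊥ := by
  rw [evalFiltration, Submodule.span_eq_bot]
  rintro v ⟨μ, hμ, -⟩
  exact absurd hμ (Nat.not_lt_zero _)

theorem mem_evalFiltration {n : ℕ} (γ : Γ) (hγ : (γ : ℕ) < n) :
    φ (1 ⊗ₜ[k] b γ) ∈ evalFiltration b φ n := Submodule.subset_span ⟨γ, hγ, rfl⟩

theorem mem_evalFiltration_of_mem_span {n : ℕ} {f : A}
    (hf : f ∈ Submodule.span k (b '' {ν | (ν : ℕ) < n})) :
    φ (1 ⊗ₜ[k] f) ∈ evalFiltration b φ n := by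
  induction hf using Submodule.span_induction with
  | mem x hx =>
    obtain ⟨ν, hν, rfl⟩ := hx
    exact mem_evalFiltration ν hν
  | zero => simp
  | add x y _ _ hx hy =>
    rw [TensorProduct.tmul_add, map_add]
    exact add_mem hx hy
  | smul c x _ hx =>
    rw [← TensorProduct.smul_tmul, ← mul_one (c • (1 : K)), ← smul_eq_mul,
      ← TensorProduct.smul_tmul', map_smul]
    exact Submodule.smul_mem _ _ hx

theorem exists_of_mem_evalFiltration_succ {n : ℕ} {v : Fin h → K}
    (hv : v ∈ evalFiltration b φ (n + 1)) (hv' : v ∉ evalFiltration b φ n) :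
    ∃ hn : n ∈ Γ, ∃ c : K, c ≠ 0 ∧ v - c • φ (1 ⊗ₜ[k] b ⟨n, hn⟩) ∈ evalFiltration b φ n := by
  have hn : n ∈ Γ := by
    by_contra hn
    refine hv' (Submodule.span_mono ?_ hv)
    rintro _ ⟨μ, hμ, rfl⟩
    refine ⟨μ, lt_of_le_of_ne (Nat.lt_succ_iff.1 hμ) ?_, rfl⟩
    rintro rfl
    exact hn μ.2
  refine ⟨hn, ?_⟩
  have hle : evalFiltration b φ (n + 1) ≤
      Submodule.span K {φ (1 ⊗ₜ[k] b ⟨n, hn⟩)} ⊔ evalFiltration b φ n := by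
    refine Submodule.span_le.2 ?_
    rintro _ ⟨⟨μ, hμΓ⟩, hμ, rfl⟩
    rcases (Nat.lt_succ_iff.1 hμ).eq_or_lt with h | h
    · subst h
      exact Submodule.mem_sup_left (Submodule.mem_span_singleton_self _)
    · exact Submodule.mem_sup_right (mem_evalFiltration _ h)
  obtain ⟨_, hx, y, hy, rfl⟩ := Submodule.mem_sup.1 (hle hv)
  obtain ⟨c, rfl⟩ := Submodule.mem_span_singleton.1 hx
  refine ⟨c, ?_, by rwa [add_sub_cancel_left]⟩
  rintro rfl
  exact hv' (by rwa [zero_smul, zero_add])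

theorem mem_jumpSet_of_mem_evalFiltration {n : ℕ} {v : Fin h → K}
    (hv : v ∈ evalFiltration b φ (n + 1)) (hv' : v ∉ evalFiltration b φ n) :
    n ∈ jumpSet b φ := by
  obtain ⟨hn, c, -, hmem⟩ := exists_of_mem_evalFiltration_succ hv hv'
  refine mem_jumpSet_iff.2 ⟨hn, fun hcon => hv' ?_⟩
  have := add_mem hmem (Submodule.smul_mem _ c hcon)
  rwa [sub_add_cancel] at this

theorem exists_jump {n : ℕ} {v : Fin h → K} (hv : v ∈ evalFiltration b φ (n + 1)) (h0 : v ≠ 0) :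
    ∃ η ≤ n, v ∈ evalFiltration b φ (η + 1) ∧ v ∉ evalFiltration b φ η := by
  induction n with
  | zero => exact ⟨0, le_rfl, hv, by simpa [evalFiltration_zero] using h0⟩
  | succ n ih =>
    by_cases hv' : v ∈ evalFiltration b φ (n + 1)
    · obtain ⟨η, hη, h1⟩ := ih hv'
      exact ⟨η, hη.trans (Nat.le_succ n), h1⟩
    · exact ⟨n + 1, le_rfl, hv, hv'⟩

/-- Vectors on different levels of the filtration are independent. -/
theorem linearIndependent_of_levels (D : Set ℕ) (w : D → Fin h → K)
    (hw : ∀ ξ : D, w ξ ∈ evalFiltration b φ (ξ + 1))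
    (hw' : ∀ ξ : D, w ξ ∉ evalFiltration b φ ξ) : LinearIndependent K w := by
  classical
  rw [linearIndependent_iff']
  intro s c hsum
  by_contra! hne
  obtain ⟨ξ₁, hξ₁, hc₁⟩ := hne
  obtain ⟨ξ, hξ, hmax⟩ := Finset.exists_max_image (s.filter fun ξ => c ξ ≠ 0)
    (fun ξ => (ξ : ℕ)) ⟨ξ₁, Finset.mem_filter.2 ⟨hξ₁, hc₁⟩⟩
  obtain ⟨hξs, hcξ⟩ := Finset.mem_filter.1 hξ
  rw [← Finset.add_sum_erase _ _ hξs] at hsum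
  refine hw' ξ ((Submodule.smul_mem_iff _ hcξ).1 ?_)
  rw [eq_neg_of_add_eq_zero_left hsum]
  refine neg_mem (sum_mem fun ζ hζ => ?_)
  obtain ⟨hζξ, hζs⟩ := Finset.mem_erase.1 hζ
  by_cases hcζ : c ζ = 0
  · rw [hcζ, zero_smul]
    exact zero_mem _
  · refine Submodule.smul_mem _ _ (evalFiltration_mono ?_ (hw ζ))
    exact lt_of_le_of_ne (hmax ζ (Finset.mem_filter.2 ⟨hζs, hcζ⟩)) fun he => hζξ (Subtype.ext he)

theorem jumpSet_subset : jumpSet b φ ⊆ Γ := fun _ hγ => (mem_jumpSet_iff.1 hγ).1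

/-- A level adds at most the line through the image of one basis element, and adds something only at
a jump. So the images at the jumps form a basis of `K^h`. -/
theorem ncard_jumpSet (htop : ∀ v, ∃ n, v ∈ evalFiltration b φ n) :
    (jumpSet b φ).ncard = h ∧ (jumpSet b φ).Finite := by
  let w : jumpSet b φ → Fin h → K := fun ξ => φ (1 ⊗ₜ[k] b ⟨ξ, jumpSet_subset ξ.2⟩)
  have hli : LinearIndependent K w := linearIndependent_of_levels (b := b) (φ := φ) _ w
    (fun ξ => mem_evalFiltration _ (Nat.lt_succ_self _)) fun ξ => (mem_jumpSet_iff.1 ξ.2).2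
  have hspan : ∀ n, evalFiltration b φ n ≤ Submodule.span K (Set.range w) := by
    intro n
    induction n with
    | zero => rw [evalFiltration_zero]; exact bot_le
    | succ n ih =>
      intro v hv
      by_cases hv' : v ∈ evalFiltration b φ n
      · exact ih hv'
      obtain ⟨hn, c, -, hmem⟩ := exists_of_mem_evalFiltration_succ hv hv'
      rw [← sub_add_cancel v (c • φ (1 ⊗ₜ[k] b ⟨n, hn⟩))]
      exact add_mem (ih hmem) (Submodule.smul_mem _ _
        (Submodule.subset_span ⟨⟨n, mem_jumpSet_of_mem_evalFiltration hv hv'⟩, rfl⟩))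
  let B := Module.Basis.mk hli fun v _ => (hspan _) (htop v).choose_spec
  have : Finite (jumpSet b φ) := Module.Finite.finite_basis B
  refine ⟨?_, Set.toFinite _⟩
  rw [← Nat.card_coe_set_eq, ← Module.finrank_eq_nat_card_basis B, Module.finrank_fin_fun]

/-- The words that vanish where `v` does form a space of dimension at most the weight of `v`. -/
theorem finrank_vanishing (v : Fin h → K) [DecidableEq K] :
    Module.finrank K ({ carrier := {x | ∀ i, v i = 0 → x i = 0}
                        zero_mem' := fun _ _ => rfl
                        add_mem' := fun hx hy i hi => by simp [hx i hi, hy i hi]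
                        smul_mem' := fun c x hx i hi => by simp [hx i hi] } :
      Submodule K (Fin h → K)) ≤ hammingNorm v := by
  rw [hammingNorm, ← Fintype.card_coe, ← Module.finrank_fintype_fun_eq_card K]
  refine LinearMap.finrank_le_finrank_of_injective
    (f := (LinearMap.funLeft K K
      (Subtype.val : {i // i ∈ Finset.univ.filter fun i => v i ≠ 0} → Fin h)).comp
      (Submodule.subtype _)) ?_
  rw [injective_iff_map_eq_zero]
  rintro ⟨x, hx⟩ h0
  ext i
  by_cases hi : v i = 0
  · exact hx i hi
  · exact congrFun h0 ⟨i, by simpa using hi⟩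

/-- The order bound for a single word. -/
theorem sigmaCount_le_hammingNorm [DecidableEq K]
    (hΓ : ∀ {m n}, m ∈ Γ → n ∈ Γ → m + n ∈ Γ)
    (hmul : ∀ μ γ : Γ, ∃ a : k, a ≠ 0 ∧ b μ * b γ - a • b ⟨μ + γ, hΓ μ.2 γ.2⟩ ∈
      Submodule.span k (b '' {ν | (ν : ℕ) < μ + γ}))
    {η : ℕ} {v : Fin h → K} (hv : v ∈ evalFiltration b φ (η + 1))
    (hv' : v ∉ evalFiltration b φ η) :
    sigmaCount Γ (jumpSet b φ) η ≤ hammingNorm v := by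
  obtain ⟨hη, c, hc, hmem⟩ := exists_of_mem_evalFiltration_succ hv hv'
  have hsmul : ∀ (a : k) (f : A), φ (1 ⊗ₜ[k] (a • f)) = algebraMap k K a • φ (1 ⊗ₜ[k] f) := by
    intro a f
    rw [← map_smul, TensorProduct.smul_tmul', TensorProduct.tmul_smul, TensorProduct.smul_tmul',
      Algebra.smul_def, smul_eq_mul]
  have hprod : ∀ μ γ : Γ, ∃ a : K, a ≠ 0 ∧
      φ (1 ⊗ₜ[k] b μ) * φ (1 ⊗ₜ[k] b γ) - a • φ (1 ⊗ₜ[k] b ⟨μ + γ, hΓ μ.2 γ.2⟩) ∈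
        evalFiltration b φ (μ + γ) := by
    intro μ γ
    obtain ⟨a, ha, hsub⟩ := hmul μ γ
    refine ⟨algebraMap k K a, by simpa using ha, ?_⟩
    have := mem_evalFiltration_of_mem_span (φ := φ) hsub
    rwa [TensorProduct.tmul_sub, map_sub, hsmul, ← mul_one (1 : K),
      ← Algebra.TensorProduct.tmul_mul_tmul, map_mul, mul_one] at this
  -- Multiplication by `φ(b γ)` shifts the filtration by `γ`, so it keeps lower terms lower.
  have hlow : ∀ (γ : Γ) (n : ℕ), ∀ x ∈ evalFiltration b φ n,
      φ (1 ⊗ₜ[k] b γ) * x ∈ evalFiltration b φ (γ + n) := by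
    intro γ n x hx
    induction hx using Submodule.span_induction with
    | mem x hx =>
      obtain ⟨μ, hμ, rfl⟩ := hx
      obtain ⟨a, -, ha⟩ := hprod γ μ
      have := add_mem (evalFiltration_mono (Nat.add_le_add_left hμ.le _) ha)
        (Submodule.smul_mem _ a (mem_evalFiltration (b := b) (φ := φ) ⟨γ + μ, hΓ γ.2 μ.2⟩
          (Nat.add_lt_add_left hμ (γ : ℕ))))
      rwa [sub_add_cancel] at this
    | zero => rw [mul_zero]; exact zero_mem _
    | add x y _ _ hx hy => rw [mul_add]; exact add_mem hx hy
    | smul c x _ hx => rw [mul_smul_comm]; exact Submodule.smul_mem _ _ hx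
  let D : Set ℕ := {ξ | ξ ∈ jumpSet b φ ∧ ∃ γ ∈ Γ, ξ = η + γ}
  choose γ hγΓ hγ using fun ξ : D => ξ.2.2
  -- The leading term of `w ξ` is a nonzero multiple of the image of `b ξ`, and `ξ` is a jump, so `w
  -- ξ` enters exactly at level `ξ`. These vectors are independent and vanish wherever `v` does.
  let w : D → Fin h → K := fun ξ => φ (1 ⊗ₜ[k] b ⟨γ ξ, hγΓ ξ⟩) * v
  have hkey : ∀ ξ : D, ∃ a : K, a ≠ 0 ∧
      w ξ - a • φ (1 ⊗ₜ[k] b ⟨ξ, jumpSet_subset ξ.2.1⟩) ∈ evalFiltration b φ ξ := by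
    intro ξ
    obtain ⟨a, ha, hsub⟩ := hprod ⟨γ ξ, hγΓ ξ⟩ ⟨η, hη⟩
    have hξ : γ ξ + η = ξ := by rw [hγ ξ, add_comm]
    refine ⟨c * a, mul_ne_zero hc ha, ?_⟩
    have h1 := hlow ⟨γ ξ, hγΓ ξ⟩ η _ hmem
    have h2 := add_mem h1 (Submodule.smul_mem _ c hsub)
    simp only [hξ] at h2
    convert h2 using 1
    simp only [w, mul_sub, smul_sub, mul_smul_comm, mul_smul]
    abel
  have hli : LinearIndependent K w := by
    refine linearIndependent_of_levels (b := b) (φ := φ) D w (fun ξ => ?_) fun ξ hcon => ?_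
    · obtain ⟨a, -, h⟩ := hkey ξ
      have := add_mem (evalFiltration_mono (Nat.le_succ _) h)
        (Submodule.smul_mem _ a (mem_evalFiltration (b := b) (φ := φ)
          ⟨ξ, jumpSet_subset ξ.2.1⟩ (Nat.lt_succ_self _)))
      rwa [sub_add_cancel] at this
    · obtain ⟨a, ha, h⟩ := hkey ξ
      have := sub_mem hcon h
      rw [sub_sub_cancel] at this
      exact (mem_jumpSet_iff.1 ξ.2.1).2 ((Submodule.smul_mem_iff _ ha).1 this)
  have : Finite D := hli.finite
  have := Fintype.ofFinite D
  refine le_trans ?_ (finrank_vanishing v)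
  have hspan := finrank_span_eq_card hli
  rw [sigmaCount, ← Nat.card_coe_set_eq, Nat.card_eq_fintype_card]
  change Fintype.card D ≤ _
  rw [← hspan]
  refine Submodule.finrank_mono (Submodule.span_le.2 ?_)
  rintro _ ⟨ξ, rfl⟩ i hi
  simp [w, hi]

end OrderBound

/-- A numerical semigroup loses at most `η` elements by the translation by `η ∈ Γ`. -/
theorem ncard_le_sigmaCount_add {Γ Δ : Set ℕ} (hΓ : ∀ {m n}, m ∈ Γ → n ∈ Γ → m + n ∈ Γ)
    (hΔ : Δ ⊆ Γ) (hfin : Δ.Finite) {η : ℕ} (hη : η ∈ Γ) :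
    Δ.ncard ≤ sigmaCount Γ Δ η + η := by
  let D : Set ℕ := {ξ | ξ ∈ Δ ∧ ∃ γ ∈ Γ, ξ = η + γ}
  have hD : D ⊆ Δ := fun ξ hξ => hξ.1
  have hrest : (Δ \ D).ncard ≤ η := by
    -- Residues modulo `0` give no bound, but translation by `0` loses nothing.
    rcases Nat.eq_zero_or_pos η with rfl | hpos
    · have : Δ \ D = ∅ := by
        rw [Set.sdiff_eq_empty]
        exact fun ξ hξ => ⟨hξ, ξ, hΔ hξ, (zero_add ξ).symm⟩
      simp [this]
    -- Of two elements of `Γ` congruent modulo `η`, the larger is the smaller plus a positive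
    -- multiple of `η`, so it lies in `η + Γ`.
    have hinj : Set.InjOn (fun ξ => ξ % η) (Δ \ D) := by
      have hmul : ∀ m x, x ∈ Γ → x + m * η ∈ Γ := by
        intro m x hx
        induction m with
        | zero => simpa using hx
        | succ m ih =>
          rw [Nat.succ_mul, ← add_assoc]
          exact hΓ ih hη
      have hlt : ∀ x ∈ Δ \ D, ∀ y ∈ Δ \ D, x % η = y % η → ¬ x < y := by
        intro x hx y hy hxy hlt
        obtain ⟨m, hm⟩ := (Nat.modEq_iff_dvd' hlt.le).1 hxy
        rcases m with _ | m
        · omega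
        · refine hy.2 ⟨hy.1, x + m * η, hmul m x (hΔ hx.1), ?_⟩
          rw [Nat.mul_succ, mul_comm] at hm
          omega
      intro x hx y hy hxy
      exact le_antisymm (not_lt.1 (hlt y hy x hx hxy.symm)) (not_lt.1 (hlt x hx y hy hxy))
    calc (Δ \ D).ncard ≤ (Set.Iio η).ncard :=
          Set.ncard_le_ncard_of_injOn _ (fun ξ _ => Nat.mod_lt ξ hpos) hinj (Set.finite_Iio η)
      _ = η := by rw [← Finset.coe_Iio, Set.ncard_coe_finset, Nat.card_Iio]
  have := Set.ncard_sdiff_add_ncard_of_subset hD hfin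
  change Δ.ncard ≤ D.ncard + η
  omega

/-! ### Values at a point and its degree -/

namespace CurvePoint

variable {k F K : Type*} [Field k] [Field F] [Algebra k F] [Field K] [Algebra k K]
  (T : CurvePoint k F K) {P : Place k F}

theorem evalRegular_eq_zero_iff (f : T.place.ring) :
    T.evalRegular f = 0 ↔ T.place.val (f : F) < 1 := by
  rw [← T.place.residue_eq_zero_iff]
  exact map_eq_zero_iff T.emb T.emb.injective

theorem evalAffine_eq_zero_iff (hT : T.place ≠ P) (f : affineRing P) :
    T.evalAffine hT f = 0 ↔ T.place.val (f : F) < 1 :=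
  T.evalRegular_eq_zero_iff _

/-- Evaluation on `R`, with values in the field of definition. -/
def evalFieldOfDef (hT : T.place ≠ P) : affineRing P →ₐ[k] T.fieldOfDef :=
  (T.evalAffine hT).codRestrict T.fieldOfDef.toSubalgebra (T.evalAffine_mem hT)

theorem value_of_mem (hT : T.place ≠ P) (f : affineRing P) :
    T.value (f : F) = T.evalFieldOfDef hT f :=
  dif_pos (affineRing_mem_ring hT f.2)

theorem finite_residueField [Finite K] : Finite T.place.residueField :=
  Finite.of_injective T.emb T.emb.injective

theorem exists_evalAffine_eq (hF : IsCurveFunctionField k F) (hP : P.degree = 1)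
    (hT : T.place ≠ P) [Finite K] {x : K} (hx : x ∈ T.fieldOfDef) :
    ∃ f : affineRing P, T.evalAffine hT f = x := by
  have := T.finite_residueField
  obtain ⟨y, rfl⟩ := hx
  obtain ⟨z, rfl⟩ := IsLocalRing.residue_surjective y
  obtain ⟨f, hf, hfz⟩ := hF.exists_mem_affineRing_val_sub_lt hP hT
    ((T.place.val_le_one_iff z).2 z.2)
  refine ⟨⟨f, hf⟩, ?_⟩
  have h := (T.evalRegular_eq_zero_iff (⟨f, affineRing_mem_ring hT hf⟩ - z)).2 hfz
  rw [map_sub, sub_eq_zero] at h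
  exact h

theorem card_fieldOfDef [Finite k] [Finite K] :
    Nat.card T.fieldOfDef = Nat.card k ^ T.degree := by
  have : Module.Finite k K := Module.Finite.of_finite
  have hdeg : T.degree = Module.finrank k T.fieldOfDef :=
    (AlgEquiv.ofInjectiveField T.emb).toLinearEquiv.finrank_eq
  rw [hdeg]
  exact Module.natCard_eq_pow_finrank

theorem degree_pos [Finite K] : 0 < T.degree := by
  have := T.finite_residueField
  have : Module.Finite k T.place.residueField := Module.Finite.of_finite
  exact Module.finrank_pos

/-- The degree is the least `l` such that all values at the point lie in the field with `q ^ l`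
elements. -/
theorem isLeast_degree [Finite k] (hF : IsCurveFunctionField k F) (hP : P.degree = 1)
    (hT : T.place ≠ P) [Finite K] :
    IsLeast {l : ℕ | 0 < l ∧ ∀ f : affineRing P,
      T.evalAffine hT f ^ (Nat.card k ^ l) = T.evalAffine hT f} T.degree := by
  refine ⟨⟨T.degree_pos, fun f => ?_⟩, fun l ⟨hl, hall⟩ => ?_⟩
  · have := Fintype.ofFinite T.fieldOfDef
    have h := FiniteField.pow_card (⟨_, T.evalAffine_mem hT f⟩ : T.fieldOfDef)
    rw [← Nat.card_eq_fintype_card, card_fieldOfDef] at h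
    exact congrArg Subtype.val h
  · have hq : 1 < Nat.card k := Finite.one_lt_card
    have hql : 1 < Nat.card k ^ l := Nat.one_lt_pow hl.ne' hq
    refine (Nat.pow_le_pow_iff_right hq).1 ?_
    rw [← card_fieldOfDef]
    classical
    -- The values at the point fill the whole field of definition, so all its `q ^ T.degree`
    -- elements are among the at most `q ^ l` roots of this polynomial.
    let p : Polynomial K := Polynomial.X ^ (Nat.card k ^ l) - Polynomial.X
    have hp : p ≠ 0 := FiniteField.X_pow_card_sub_X_ne_zero K hql
    have hsub : (T.fieldOfDef : Set K) ⊆ p.roots.toFinset := by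
      intro x hx
      obtain ⟨f, rfl⟩ := T.exists_evalAffine_eq hF hP hT hx
      simp [p, hp, Polynomial.mem_roots, hall f, -Polynomial.mem_roots']
    calc Nat.card T.fieldOfDef = (T.fieldOfDef : Set K).ncard := Nat.card_coe_set_eq _
      _ ≤ p.roots.toFinset.card := by
        rw [← Set.ncard_coe_finset]
        exact Set.ncard_le_ncard hsub (Finset.finite_toSet _)
      _ ≤ p.natDegree := (Multiset.toFinset_card_le _).trans p.card_roots'
      _ = Nat.card k ^ l := FiniteField.X_pow_card_sub_X_natDegree_eq K hql

end CurvePoint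

/-! ### The evaluation morphism and the one-point code -/

section OnePoint

variable {k F K : Type*} [Field k] [Field F] [Algebra k F] [Field K] [Algebra k K] {h : ℕ}
  {P : Place k F} (pt : Fin h → CurvePoint k F K) (hpt : ∀ i, (pt i).place ≠ P)

/-- Products of separating functions vanish at all points but one. Scalars from `K` adjust the
remaining value, so surjectivity onto the residue fields is not needed. -/
theorem evalMorphism_surjective (hF : IsCurveFunctionField k F) (hP : P.degree = 1)
    (hdist : Function.Injective fun i => (pt i).place) :
    Function.Surjective (evalMorphism P pt hpt) := by
  classical
  have hsep : ∀ i j : Fin h, ∃ g : affineRing P, (pt i).evalAffine (hpt i) g ≠ 0 ∧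
      (j ≠ i → (pt j).evalAffine (hpt j) g = 0) := by
    intro i j
    by_cases hij : j = i
    · exact ⟨1, by simp, fun h => absurd hij h⟩
    · obtain ⟨g, hg, hgj, hgi⟩ := hF.exists_mem_affineRing_separating hP (hpt j) (hpt i)
        fun h => hij (hdist h)
      refine ⟨⟨g, hg⟩, fun h => ?_, fun _ => ?_⟩
      · exact (((pt i).evalAffine_eq_zero_iff (hpt i) _).1 h).ne hgi
      · exact ((pt j).evalAffine_eq_zero_iff (hpt j) _).2 hgj
  choose g hg hg0 using hsep
  let f : Fin h → affineRing P := fun i => ∏ j, g i j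
  have hfi : ∀ i, (pt i).evalAffine (hpt i) (f i) ≠ 0 := fun i => by
    rw [map_prod]
    exact Finset.prod_ne_zero_iff.2 fun j _ => hg i j
  have hfj : ∀ i j, j ≠ i → (pt j).evalAffine (hpt j) (f i) = 0 := fun i j hij => by
    rw [map_prod]
    exact Finset.prod_eq_zero (Finset.mem_univ j) (hg0 i j hij)
  intro v
  refine ⟨∑ i, (v i / (pt i).evalAffine (hpt i) (f i)) • (1 ⊗ₜ[k] f i), ?_⟩
  ext j
  rw [map_sum, Finset.sum_apply, Finset.sum_eq_single j]
  · rw [map_smul, Pi.smul_apply, evalMorphism_tmul, smul_eq_mul, div_mul_cancel₀ _ (hfi j)]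
  · intro i _ hij
    rw [map_smul, Pi.smul_apply, evalMorphism_tmul, hfj i j hij.symm, smul_zero]
  · exact fun h => absurd (Finset.mem_univ j) h

variable {b : weierstrassSemigroup P → affineRing P}

theorem exists_mem_evalFiltration (hF : IsCurveFunctionField k F) (hP : P.degree = 1)
    (hdist : Function.Injective fun i => (pt i).place)
    (hb : ∀ γ, P.val (b γ : F) = WithZero.exp ((γ : ℕ) : ℤ)) (v : Fin h → K) :
    ∃ n, v ∈ evalFiltration b (evalMorphism P pt hpt) n := by
  obtain ⟨x, rfl⟩ := evalMorphism_surjective pt hpt hF hP hdist v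
  induction x using TensorProduct.induction_on with
  | zero => exact ⟨0, by simp⟩
  | tmul c f =>
    obtain ⟨n, hn⟩ : ∃ n : ℕ, P.val (f : F) < WithZero.exp (n : ℤ) := by
      obtain ⟨m, hm⟩ := f.2
      refine ⟨m + 1, (mem_riemannRochSpace_single.1 hm).1.trans_lt ?_⟩
      rw [WithZero.exp_lt_exp]
      omega
    refine ⟨n, ?_⟩
    rw [show c ⊗ₜ[k] f = c • (1 ⊗ₜ[k] f) by rw [TensorProduct.smul_tmul', smul_eq_mul, mul_one],
      map_smul]
    exact Submodule.smul_mem _ _ (mem_evalFiltration_of_mem_span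
      (mem_span_of_val_lt hF hP hb n f hn))
  | add x y hx hy =>
    obtain ⟨m, hm⟩ := hx
    obtain ⟨n, hn⟩ := hy
    exact ⟨max m n, by
      rw [map_add]
      exact add_mem (evalFiltration_mono (le_max_left m n) hm)
        (evalFiltration_mono (le_max_right m n) hn)⟩

/-- The encoding `f ↦ (π_1 (f(P_1)), …, π_h (f(P_h)))` on `R`. -/
def encode {n : Fin h → ℕ} (π : ∀ i, (pt i).fieldOfDef →ₗ[k] (Fin (n i) → k)) :
    affineRing P →ₗ[k] ((Σ i : Fin h, Fin (n i)) → k) where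
  toFun f := concatWord π fun i => (pt i).evalFieldOfDef (hpt i) f
  map_add' f g := by
    funext j
    simp only [concatWord, map_add, Pi.add_apply]
  map_smul' c f := by
    funext j
    simp only [concatWord, map_smul, Pi.smul_apply, RingHom.id_apply]

theorem encode_apply {n : Fin h → ℕ} (π : ∀ i, (pt i).fieldOfDef →ₗ[k] (Fin (n i) → k))
    (f : affineRing P) (j : Σ i : Fin h, Fin (n i)) :
    encode pt hpt π f j = π j.1 ((pt j.1).evalFieldOfDef (hpt j.1) f) j.2 := rfl

/-- The `b η` with `η ≤ lam` span the space `L(lam P)`, so by linearity their words span its image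
under `encode`. With `mem_gagCode_iff` this identifies the two codes. -/
theorem mem_extendedCode_iff (hF : IsCurveFunctionField k F) (hP : P.degree = 1)
    (hb : ∀ γ, P.val (b γ : F) = WithZero.exp ((γ : ℕ) : ℤ)) {n : Fin h → ℕ}
    (π : ∀ i, (pt i).fieldOfDef →ₗ[k] (Fin (n i) → k)) (lam : ℕ)
    (c : (Σ i : Fin h, Fin (n i)) → k) :
    c ∈ extendedCode b (evalMorphism P pt hpt) (fun i => (pt i).fieldOfDef)
        (evalMorphism_mem P pt hpt) π lam ↔
      ∃ f : affineRing P, P.val (f : F) ≤ WithZero.exp (lam : ℤ) ∧ encode pt hpt π f = c := by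
  have hset : {c | ∃ η : weierstrassSemigroup P, (η : ℕ) ≤ lam ∧
      c = concatWord π fun i => ⟨evalMorphism P pt hpt (1 ⊗ₜ[k] b η) i,
        evalMorphism_mem P pt hpt i (b η)⟩} =
      encode pt hpt π '' (b '' {ν | (ν : ℕ) < lam + 1}) := by
    have henc : ∀ η, (concatWord π fun i => ⟨evalMorphism P pt hpt (1 ⊗ₜ[k] b η) i,
        evalMorphism_mem P pt hpt i (b η)⟩) = encode pt hpt π (b η) := fun η => by
      funext j
      exact congrArg (fun v => π j.1 v j.2) (Subtype.ext (evalMorphism_tmul P pt hpt (b η) j.1))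
    ext c
    constructor
    · rintro ⟨η, hη, rfl⟩
      exact ⟨_, ⟨η, Nat.lt_succ_of_le hη, rfl⟩, (henc η).symm⟩
    · rintro ⟨_, ⟨η, hη, rfl⟩, rfl⟩
      exact ⟨η, Nat.lt_succ_iff.1 hη, (henc η).symm⟩
  rw [extendedCode, hset, ← Submodule.map_span, Submodule.mem_map]
  refine exists_congr fun f => and_congr ⟨fun hf => ?_, fun hf => ?_⟩ Iff.rfl
  · induction hf using Submodule.span_induction with
    | mem x hx =>
      obtain ⟨ν, hν, rfl⟩ := hx
      rw [hb, WithZero.exp_le_exp, Nat.cast_le]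
      exact Nat.lt_succ_iff.1 hν
    | zero => simp
    | add x y _ _ hx hy => exact (P.val.map_add _ _).trans (max_le hx hy)
    | smul a x _ hx => exact (P.val_smul_le a _).trans hx
  · refine mem_span_of_val_lt hF hP hb _ f (hf.trans_lt ?_)
    rw [WithZero.exp_lt_exp]
    omega

theorem mem_gagCode_iff {n : Fin h → ℕ}
    (π : ∀ i, (pt i).fieldOfDef →ₗ[k] (Fin (n i) → k)) (lam : ℕ)
    (c : (Σ i : Fin h, Fin (n i)) → k) :
    c ∈ gagCode pt (Finsupp.single P (lam : ℤ)) π ↔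
      ∃ f : affineRing P, P.val (f : F) ≤ WithZero.exp (lam : ℤ) ∧ encode pt hpt π f = c := by
  have henc : ∀ f : affineRing P,
      (concatWord π fun i => (pt i).value (f : F)) = encode pt hpt π f := fun f => by
    funext j
    rw [encode_apply, concatWord, (pt j.1).value_of_mem (hpt j.1)]
  constructor
  · rintro ⟨f, hf, rfl⟩
    exact ⟨⟨f, lam, hf⟩, (mem_riemannRochSpace_single.1 hf).1, (henc ⟨f, lam, hf⟩).symm⟩
  · rintro ⟨f, hf, rfl⟩
    exact ⟨f, mem_riemannRochSpace_single.2 ⟨hf, mem_affineRing_iff.1 f.2⟩, (henc f).symm⟩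

/-- Each `π i` is injective, so a nonzero symbol becomes a nonzero block and contributes at least
one nonzero position. -/
theorem hammingNorm_le_hammingNorm_encode [DecidableEq k] [DecidableEq K] {n : Fin h → ℕ}
    (π : ∀ i, (pt i).fieldOfDef ≃ₗ[k] (Fin (n i) → k)) (f : affineRing P) :
    hammingNorm (evalMorphism P pt hpt (1 ⊗ₜ[k] f)) ≤
      hammingNorm (encode pt hpt (fun i => (π i).toLinearMap) f) := by
  classical
  have hex : ∀ i, evalMorphism P pt hpt (1 ⊗ₜ[k] f) i ≠ 0 →
      ∃ j, encode pt hpt (fun i => (π i).toLinearMap) f ⟨i, j⟩ ≠ 0 := by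
    intro i hi
    rw [evalMorphism_tmul] at hi
    by_contra! hall
    have h0 : π i ((pt i).evalFieldOfDef (hpt i) f) = 0 := funext hall
    rw [LinearEquiv.map_eq_zero_iff] at h0
    exact hi (congrArg Subtype.val h0)
  rw [hammingNorm, hammingNorm]
  refine le_trans (Finset.card_le_card fun i hi => ?_) (Finset.card_image_le (f := Sigma.fst))
  obtain ⟨j, hj⟩ := hex i (Finset.mem_filter.1 hi).2
  exact Finset.mem_image.2 ⟨⟨i, j⟩, Finset.mem_filter.2 ⟨Finset.mem_univ _, hj⟩, rfl⟩

theorem encode_eq_zero {n : Fin h → ℕ} (π : ∀ i, (pt i).fieldOfDef →ₗ[k] (Fin (n i) → k))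
    {f : affineRing P} (hf : evalMorphism P pt hpt (1 ⊗ₜ[k] f) = 0) : encode pt hpt π f = 0 := by
  funext j
  have := congrFun hf j.1
  rw [evalMorphism_tmul] at this
  rw [encode_apply, show (pt j.1).evalFieldOfDef (hpt j.1) f = 0 from Subtype.ext this, map_zero]
  rfl

/-- The element of exponent `0` is a nonzero constant, so it does not vanish at the first point,
which exists as `h > 0`. This makes the code nonzero and the minimum defining `orderBound` one over
a nonempty set. -/
theorem zero_mem_jumpSet (hh : 0 < h)
    (hb : ∀ γ, P.val (b γ : F) = WithZero.exp ((γ : ℕ) : ℤ)) (hF : IsCurveFunctionField k F)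
    (hP : P.degree = 1) : 0 ∈ jumpSet b (evalMorphism P pt hpt) := by
  refine mem_jumpSet_iff.2 ⟨zero_mem_weierstrassSemigroup, ?_⟩
  rw [evalFiltration_zero, Submodule.mem_bot]
  intro h0
  have h1 := congrFun h0 ⟨0, hh⟩
  rw [evalMorphism_tmul, Pi.zero_apply, CurvePoint.evalAffine_eq_zero_iff] at h1
  obtain ⟨a, ha, hlt⟩ := P.exists_val_sub_smul_lt hP
    (f := b ⟨0, zero_mem_weierstrassSemigroup⟩) one_ne_zero (by rw [hb]; simp)
  have hz := eq_zero_of_mem_affineRing_of_val_lt_one hF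
    (sub_mem (b ⟨0, zero_mem_weierstrassSemigroup⟩).2 ((affineRing P).smul_mem (one_mem _) a))
    (by simpa using hlt)
  rw [sub_eq_zero.1 hz, Place.val_smul _ ha, map_one] at h1
  exact h1.false

end OnePoint

/-- The zero code is excluded because its set of distances is empty, and `sInf ∅ = 0` in `ℕ`. -/
theorem le_minDistance {k ι : Type*} [Field k] [DecidableEq k] [Fintype ι]
    {C : Submodule k (ι → k)} {N : ℕ} (hC : C ≠ ⊥)
    (h : ∀ x ∈ C, x ≠ 0 → N ≤ hammingNorm x) : N ≤ minDistance C := by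
  obtain ⟨x, hx, hx0⟩ := Submodule.exists_mem_ne_zero_of_ne_bot hC
  refine le_csInf ⟨_, x, hx, 0, zero_mem _, hx0, rfl⟩ ?_
  rintro d ⟨x, hx, y, hy, hxy, rfl⟩
  have := h (-x + y) (add_mem (neg_mem hx) hy) fun he => hxy (neg_add_eq_zero.1 he)
  rw [← hammingDist_eq_hammingNorm] at this
  exact this.trans_eq (by congr!)

theorem orderBound_le {Γ Δ : Set ℕ} {lam η : ℕ} (hη : η ∈ Δ) (hle : η ≤ lam) :
    orderBound Γ Δ lam ≤ sigmaCount Γ Δ η := Nat.sInf_le ⟨η, hη, hle, rfl⟩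

/-! ### The order bound for the extended code -/

section Main

variable {k F K : Type*} [Field k] [Field F] [Algebra k F] [Field K] [Algebra k K] {h : ℕ}
  {P : Place k F} (pt : Fin h → CurvePoint k F K) (hpt : ∀ i, (pt i).place ≠ P)
  {b : weierstrassSemigroup P → affineRing P}

theorem orderBound_le_hammingNorm [DecidableEq K] (hF : IsCurveFunctionField k F)
    (hP : P.degree = 1) (hb : ∀ γ, P.val (b γ : F) = WithZero.exp ((γ : ℕ) : ℤ)) {lam : ℕ}
    {f : affineRing P} (hf : P.val (f : F) ≤ WithZero.exp (lam : ℤ))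
    (hne : evalMorphism P pt hpt (1 ⊗ₜ[k] f) ≠ 0) :
    orderBound (weierstrassSemigroup P) (jumpSet b (evalMorphism P pt hpt)) lam ≤
      hammingNorm (evalMorphism P pt hpt (1 ⊗ₜ[k] f)) := by
  have hlt : P.val (f : F) < WithZero.exp ((lam + 1 : ℕ) : ℤ) :=
    hf.trans_lt (WithZero.exp_lt_exp.2 (by omega))
  obtain ⟨η, hη, h1, h2⟩ := exists_jump
    (mem_evalFiltration_of_mem_span (φ := evalMorphism P pt hpt)
      (mem_span_of_val_lt hF hP hb _ f hlt)) hne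
  have hs := sigmaCount_le_hammingNorm (Γ := weierstrassSemigroup P) (b := b)
    add_mem_weierstrassSemigroup (mul_sub_smul_mem_span hF hP hb) h1 h2
  exact (orderBound_le (mem_jumpSet_of_mem_evalFiltration h1 h2) hη).trans hs

theorem orderBound_le_minDistance (hF : IsCurveFunctionField k F) (hP : P.degree = 1)
    (hh : 0 < h) (hb : ∀ γ, P.val (b γ : F) = WithZero.exp ((γ : ℕ) : ℤ)) {n : Fin h → ℕ}
    (π : ∀ i, (pt i).fieldOfDef ≃ₗ[k] (Fin (n i) → k)) (lam : ℕ) :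
    orderBound (weierstrassSemigroup P) (jumpSet b (evalMorphism P pt hpt)) lam ≤
      minDistance (extendedCode b (evalMorphism P pt hpt) (fun i => (pt i).fieldOfDef)
        (evalMorphism_mem P pt hpt) (fun i => (π i).toLinearMap) lam) := by
  classical
  have hcode := mem_extendedCode_iff pt hpt hF hP hb (fun i => (π i).toLinearMap) lam
  have h0 : 0 ∈ jumpSet b (evalMorphism P pt hpt) := zero_mem_jumpSet pt hpt hh hb hF hP
  refine le_minDistance (fun hbot => ?_) fun x hx hx0 => ?_
  · obtain ⟨hΓ, hnot⟩ := mem_jumpSet_iff.1 h0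
    have hlow : P.val (b ⟨0, hΓ⟩ : F) ≤ WithZero.exp (lam : ℤ) := by
      rw [hb, WithZero.exp_le_exp, Nat.cast_le]
      exact Nat.zero_le lam
    have hmem := (hcode _).2 ⟨_, hlow, rfl⟩
    rw [hbot, Submodule.mem_bot] at hmem
    have hnorm := hammingNorm_le_hammingNorm_encode pt hpt π (b ⟨0, hΓ⟩)
    rw [hmem, hammingNorm_zero, Nat.le_zero, hammingNorm_eq_zero] at hnorm
    exact hnot (hnorm ▸ zero_mem _)
  · obtain ⟨f, hf, rfl⟩ := (hcode _).1 hx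
    exact (orderBound_le_hammingNorm pt hpt hF hP hb hf
      fun he => hx0 (encode_eq_zero pt hpt _ he)).trans
        (hammingNorm_le_hammingNorm_encode pt hpt π f)

end Main

end

theorem mainTheorem3 {k F K : Type*} [Field k] [Finite k] [Field F] [Algebra k F]
    (hF : IsCurveFunctionField k F)
    [Field K] [Algebra k K] [FiniteDimensional k K]
    (P : Place k F) (hP : P.degree = 1)
    {h : ℕ} (hh : 0 < h) (pt : Fin h → CurvePoint k F K)
    (hpt : ∀ i, (pt i).place ≠ P)
    (hdist : Function.Injective fun i => (pt i).place)
    (b : weierstrassSemigroup P → affineRing P)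
    (hb : ∀ γ : weierstrassSemigroup P,
      P.poleOrder (b γ : F) = (((γ : ℕ) : ℤ) : WithBot ℤ))
    (π : ∀ i, (pt i).fieldOfDef ≃ₗ[k] (Fin (pt i).degree → k))
    (lam : ℕ) :
    -- `(R, ρ, Γ)` is an order domain over `k`
    (IsWeightFunction k (fun f : affineRing P => P.poleOrder (f : F)) ∧
      Set.range (fun f : affineRing P => P.poleOrder (f : F)) =
        insert ⊥ ((fun n : ℕ => ((n : ℤ) : WithBot ℤ)) '' weierstrassSemigroup P)) ∧
    -- `φ` is a morphism (it is onto), and `r_i` is the least `l` with `φ_i(R) ⊆ F_{q^l}`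
    (Function.Surjective (evalMorphism P pt hpt) ∧
      ∀ i, IsLeast {l : ℕ | 0 < l ∧ ∀ f : affineRing P,
        evalMorphism P pt hpt (1 ⊗ₜ[k] f) i ^ (Nat.card k ^ l) =
          evalMorphism P pt hpt (1 ⊗ₜ[k] f) i} (pt i).degree) ∧
    -- `Δ` consists of `h` exponents
    (jumpSet b (evalMorphism P pt hpt)).ncard = h ∧
    -- the one-point code is the extended order domain code
    gagCode pt (Finsupp.single P (lam : ℤ)) (fun i => (π i).toLinearMap) =
      ↑(extendedCode b (evalMorphism P pt hpt) (fun i => (pt i).fieldOfDef)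
        (evalMorphism_mem P pt hpt) (fun i => (π i).toLinearMap) lam) ∧
    -- the bound on the minimum distance
    orderBound (weierstrassSemigroup P) (jumpSet b (evalMorphism P pt hpt)) lam ≤
      minDistance (extendedCode b (evalMorphism P pt hpt) (fun i => (pt i).fieldOfDef)
        (evalMorphism_mem P pt hpt) (fun i => (π i).toLinearMap) lam) ∧
    -- the comparison with the number of points
    (h : ℤ) - (lam : ℤ) ≤
      (orderBound (weierstrassSemigroup P) (jumpSet b (evalMorphism P pt hpt)) lam : ℤ) := by
  classical
  have : Finite K := Module.finite_of_finite k
  have hb' : ∀ γ, P.val (b γ : F) = WithZero.exp ((γ : ℕ) : ℤ) := fun γ =>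
    P.poleOrder_eq_coe_iff.1 (hb γ)
  obtain ⟨hcard, hfin⟩ := ncard_jumpSet (exists_mem_evalFiltration pt hpt hF hP hdist hb')
  have h0 : 0 ∈ jumpSet b (evalMorphism P pt hpt) := zero_mem_jumpSet pt hpt hh hb' hF hP
  refine ⟨⟨isWeightFunction_poleOrder hP, range_poleOrder hF⟩,
    ⟨evalMorphism_surjective pt hpt hF hP hdist, fun i => ?_⟩, hcard, ?_, ?_, ?_⟩
  · simpa only [evalMorphism_tmul] using (pt i).isLeast_degree hF hP (hpt i)
  · ext c
    exact (mem_gagCode_iff pt hpt _ lam c).trans (mem_extendedCode_iff pt hpt hF hP hb' _ lam c).symm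
  · exact orderBound_le_minDistance pt hpt hF hP hh hb' π lam
  -- The minimum is attained at some `η ≤ lam`, the candidates including `0`; then `h ≤ σ_Δ(η) + η ≤
  -- σ_Δ(η) + lam`.
  · obtain ⟨η, hη, hηlam, hs⟩ := Nat.sInf_mem
      (s := {s | ∃ η ∈ jumpSet b (evalMorphism P pt hpt), η ≤ lam ∧
        s = sigmaCount (weierstrassSemigroup P) (jumpSet b (evalMorphism P pt hpt)) η})
      ⟨_, 0, h0, Nat.zero_le _, rfl⟩
    have hle := ncard_le_sigmaCount_add (fun hm hn => add_mem_weierstrassSemigroup hm hn)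
      jumpSet_subset hfin (jumpSet_subset hη)
    rw [hcard] at hle
    rw [orderBound, hs]
    omega
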